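/- Let $n\ge 1$ be an integer and $s\in(0,1)$. For $t\in\mathbb R$ put $$g_s(t)=\frac1{(1+t^2)^{\frac{n+1+s}2}},\qquad G_s(t)=\int_0^t g_s(\tau)\,d\tau,\qquad \mathcal G_s(t)=\int_0^t G_s(\tau)\,d\tau .$$ For $\Omega\subset\mathbb R^n$ a ball, $A\subset\Omega$ measurable, $\psi\in L^\infty(A)$ and $\varphi\colon\mathbb R^n\to\mathbb R$ measurable, let $\mathcal W^s_{\varphi,\psi}(\Omega,A)$ be the set of all $u\colon\mathbb R^n\to\mathbb R$ such that $u|_\Omega\in W^{s,1}(\Omega)$, i.e. $u\in L^1(\Omega)$ and $\int_\Omega\int_\Omega\frac{|u(x)-u(y)|}{|x-y|^{n+s}}\,dx\,dy<\infty$, such that $u=\varphi$ on $\mathbb R^n\setminus\Omega$, and $u\ge\psi$ a.e. in $A$. We say that $u\in\mathcal W^s_{\varphi,\psi}(\Omega,A)$ solves the obstacle problem in $\Omega$ if for every $v\in\mathcal W^s_{\varphi,\psi}(\Omega,A)$ $$\iint_{\mathbb R^{2n}\setminus(\mathbb R^n\setminus\Omega)^2}\left\{\mathcal G_s\!\left(\frac{u(x)-u(y)}{|x-y|}\right)-\mathcal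 G_s\!\left(\frac{v(x)-v(y)}{|x-y|}\right)\right\}\frac{dx\,dy}{|x-y|^{n-1+s}}\le 0 .$$ **Theorem.** There is a constant $C=C(n,s)>0$ such that the following holds. Let $x_0\in\mathbb R^n$, $R>0$, and write $B_r=\{x\in\mathbb R^n : |x-x_0|<r\}$. Let $\varphi\colon\mathbb R^n\to\mathbb R$ be measurable, $A\subset B_{2R}$ measurable (for instance open) and $\psi\in L^\infty(A)$. If $u\in\mathcal W^s_{\varphi,\psi}(B_{2R},A)$ solves the obstacle problem in $B_{2R}$, then $$\sup_{B_R}u\le\max\left\{C\left(R+\frac1{|B_{2R}|}\int_{B_{2R}}u_+(x)\,dx\right),\ \sup_A\psi_+\right\},$$ where $t_+=\max\{t,0\}$, the suprema are essential suprema with respect to Lebesgue measure, and the supremum over a null set is $-\infty$. -/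

import Mathlib

open MeasureTheory

noncomputable section

namespace NonlocalObstacle

/-- The space `ℝⁿ` with its Euclidean norm. -/
abbrev Rn (n : ℕ) : Type := EuclideanSpace ℝ (Fin n)

/-- `g_s(t) = (1 + t²)^{-(n+1+s)/2}`. -/
def gs (n : ℕ) (s t : ℝ) : ℝ :=
  1 / (1 + t ^ 2) ^ (((n : ℝ) + 1 + s) / 2)

/-- `G_s(t) = ∫₀ᵗ g_s(τ) dτ`. -/
def Gs (n : ℕ) (s t : ℝ) : ℝ :=
  ∫ τ in (0 : ℝ)..t, gs n s τ

/-- `𝒢_s(t) = ∫₀ᵗ G_s(τ) dτ`. -/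
def GGs (n : ℕ) (s t : ℝ) : ℝ :=
  ∫ τ in (0 : ℝ)..t, Gs n s τ

/-- The Gagliardo seminorm `[u]_{W^{s,1}(Ω)} = ∫_Ω ∫_Ω |u(x) - u(y)| / |x - y|^{n+s} dx dy`,
with values in `[0, ∞]`. -/
def gagliardo {n : ℕ} (s : ℝ) (Ω : Set (Rn n)) (u : Rn n → ℝ) : ENNReal :=
  ∫⁻ x in Ω, ∫⁻ y in Ω, ENNReal.ofReal (|u x - u y| / ‖x - y‖ ^ ((n : ℝ) + s))

/-- `𝒲^s(Ω)`: the functions `u : ℝⁿ → ℝ` whose restriction to `Ω` lies in `W^{s,1}(Ω)`. -/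
def W {n : ℕ} (s : ℝ) (Ω : Set (Rn n)) : Set (Rn n → ℝ) :=
  {u | IntegrableOn u Ω ∧ gagliardo s Ω u < ⊤}

/-- `𝒲^s_{φ,ψ}(Ω, A)`: the functions of `𝒲^s(Ω)` that equal `φ` outside `Ω` and lie above the
obstacle `ψ` almost everywhere in `A`. Only the values of `ψ` on `A` matter. -/
def WObst {n : ℕ} (s : ℝ) (φ ψ : Rn n → ℝ) (Ω A : Set (Rn n)) : Set (Rn n → ℝ) :=
  {u | u ∈ W s Ω ∧ (∀ x, x ∉ Ω → u x = φ x) ∧ ∀ᵐ x ∂(volume.restrict A), ψ x ≤ u x}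

/-- `Q(Ω) = ℝ²ⁿ \ (𝒞Ω)²`. -/
def Q {n : ℕ} (Ω : Set (Rn n)) : Set (Rn n × Rn n) :=
  (Ωᶜ ×ˢ Ωᶜ)ᶜ

/-- `u` solves the obstacle problem in `Ω` with exterior data `φ` and obstacle `ψ` on `A`:
it minimizes the fractional area functional in `𝒲^s_{φ,ψ}(Ω, A)`, the energies (each of which may
be infinite) being compared through the integral of their difference. For `Ω` bounded with
Lipschitz boundary and `φ` measurable, this integral converges absolutely, because `𝒢_s` is
Lipschitz and `u - v` is the extension by zero of a function in `W^{s,1}(Ω)`. -/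
def SolvesObstacle {n : ℕ} (s : ℝ) (φ ψ : Rn n → ℝ) (Ω A : Set (Rn n)) (u : Rn n → ℝ) : Prop :=
  u ∈ WObst s φ ψ Ω A ∧
    ∀ v ∈ WObst s φ ψ Ω A,
      ∫ p in Q Ω,
        (GGs n s ((u p.1 - u p.2) / ‖p.1 - p.2‖) - GGs n s ((v p.1 - v p.2) / ‖p.1 - p.2‖))
          / ‖p.1 - p.2‖ ^ ((n : ℝ) - 1 + s) ≤ 0

/-- The (essential) supremum of `f` over `S`, as an extended real number; it is `-∞` if `S` is
a null set. -/
def supOn {n : ℕ} (S : Set (Rn n)) (f : Rn n → ℝ) : EReal :=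
  essSup (fun x => (f x : EReal)) (volume.restrict S)

end NonlocalObstacle

end

/-!
The proof compares `u` with lower hemispheres. Let `K` be a level that is at least `C (R + ⨍ u₊)` and
at least `sup_A ψ₊`. Over a ball `B_r(x₁)` with `R / 4 < r < R / 2` take the barrier
`k = K + hemi r x₁`, a lower hemisphere that touches the level `K` at `x₁` and becomes vertical at
the boundary of the ball. The competitor `v` equal to `min u k` in the ball and to `u` elsewhere is
admissible, because `k ≥ K ≥ ψ` on `A`. By convexity of `𝒢_s`, minimality of `u` gives, with
`w = u - v = (u - k)₊ 1_{B_r}`,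

  `∬ G_s((v(x) - v(y)) / |x - y|) (w(x) - w(y)) |x - y|^{-(n+s)} dx dy ≤ 0`  (`linearized_inequality`).

The left side is twice the integral of `w` against the flux
`∫ G_s((v(x) - v(y)) / |x - y|) |x - y|^{-(n+s)} dy`, in the principal value sense. So it is enough
that this flux is bounded below by a positive constant at every point where `w > 0`
(`ae_eq_zero_of_flux`): then `w = 0`, which says `u ≤ k` on `B_r(x₁)`, and letting `x₁` run through
a dense set gives `u ≤ K` on `B_R`.

For the flux (`flux_lower_bound`) note that `G_s(a/|y|) |y|^{-(n+s)}` is the integral of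
`|Y|^{-(n+1+s)}` over the vertical segment of `ℝⁿ⁺¹` over `y` between the heights `0` and `a`. The
flux is therefore the fractional mean curvature of the graph of `v` at a point of the hemisphere,
that is, the integral of `|Y|^{-(n+1+s)}` over the region above the graph minus half its integral
over `ℝⁿ⁺¹`. The region above the graph contains the ball `B` bounded by the hemisphere. As `B` and
its reflection `-B` in the point carry equal mass, `B` alone costs at most half the integral over
the complement of `B ∪ -B`, which is `O(r^{-s})` (`lintegral_kern_le`). The region also contains,
at heights near `K`, everything that does not lie over `T = {u ≥ K / 2}`; by Chebyshev's inequality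
`|T|` is a small fraction of `R^n` if `C` is large, so that this contributes at least `c (θ R)^{-s}`
with `θ` as small as desired. The gain beats the loss, uniformly in `x`.

The competitor has finite energy relative to `u` if the sphere `∂B_r(x₁)` is crossed by finite
interaction weighted with `|u|`. By Tonelli's theorem this holds for almost every `r`
(`exists_radius`).
-/

noncomputable section

namespace NonlocalObstacle

open scoped RealInnerProductSpace

/-! ### The functions `g_s`, `G_s`, `𝒢_s` -/

lemma continuous_gs (n : ℕ) (s : ℝ) : Continuous (gs n s) := by
  unfold gs
  refine continuous_const.div ?_ fun t => (Real.rpow_pos_of_pos (by positivity) _).ne'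
  exact (by fun_prop : Continuous fun t : ℝ => 1 + t ^ 2).rpow_const
    fun t => Or.inl (by positivity)

lemma gs_nonneg (n : ℕ) (s t : ℝ) : 0 ≤ gs n s t := by
  unfold gs; positivity

lemma gs_le {n : ℕ} (hn : 1 ≤ n) {s : ℝ} (hs : 0 < s) (t : ℝ) : gs n s t ≤ (1 + t ^ 2)⁻¹ := by
  unfold gs
  rw [one_div]
  have hn' : (1 : ℝ) ≤ n := by exact_mod_cast hn
  have h1 : (1 : ℝ) ≤ 1 + t ^ 2 := by nlinarith [sq_nonneg t]
  gcongr
  calc 1 + t ^ 2 = (1 + t ^ 2) ^ (1 : ℝ) := (Real.rpow_one _).symm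
    _ ≤ _ := Real.rpow_le_rpow_of_exponent_le h1 (by linarith)

lemma integrable_gs {n : ℕ} (hn : 1 ≤ n) {s : ℝ} (hs : 0 < s) : Integrable (gs n s) := by
  refine integrable_inv_one_add_sq.mono' (continuous_gs n s).aestronglyMeasurable
    (ae_of_all _ fun t => ?_)
  rw [Real.norm_of_nonneg (gs_nonneg n s t)]
  exact gs_le hn hs t

lemma continuous_Gs (n : ℕ) (s : ℝ) : Continuous (Gs n s) :=
  intervalIntegral.continuous_primitive
    (fun _ _ => (continuous_gs n s).intervalIntegrable _ _) 0

lemma monotone_Gs (n : ℕ) (s : ℝ) : Monotone (Gs n s) := by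
  intro a b hab
  have h := intervalIntegral.integral_interval_sub_left (μ := volume)
    ((continuous_gs n s).intervalIntegrable 0 b) ((continuous_gs n s).intervalIntegrable 0 a)
  have h0 : 0 ≤ ∫ t in a..b, gs n s t :=
    intervalIntegral.integral_nonneg hab fun t _ => gs_nonneg n s t
  unfold Gs
  linarith

lemma abs_Gs_le {n : ℕ} (hn : 1 ≤ n) {s : ℝ} (hs : 0 < s) (t : ℝ) :
    |Gs n s t| ≤ ∫ τ, gs n s τ := by
  refine (intervalIntegral.norm_integral_le_integral_norm_uIoc (f := gs n s)).trans ?_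
  simp_rw [Real.norm_of_nonneg (gs_nonneg n s _)]
  exact setIntegral_le_integral (integrable_gs hn hs) (ae_of_all _ (gs_nonneg n s))

lemma Gs_neg (n : ℕ) (s t : ℝ) : Gs n s (-t) = -Gs n s t := by
  unfold Gs
  have h := intervalIntegral.integral_comp_neg (a := 0) (b := t) (fun x => gs n s x)
  have h2 : ∀ x, gs n s (-x) = gs n s x := fun x => by simp [gs]
  simp only [h2, neg_zero] at h
  rw [h, intervalIntegral.integral_symm]

lemma continuous_GGs (n : ℕ) (s : ℝ) : Continuous (GGs n s) :=
  intervalIntegral.continuous_primitive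
    (fun _ _ => (continuous_Gs n s).intervalIntegrable _ _) 0

lemma GGs_sub (n : ℕ) (s a b : ℝ) : GGs n s a - GGs n s b = ∫ t in b..a, Gs n s t :=
  intervalIntegral.integral_interval_sub_left
    ((continuous_Gs n s).intervalIntegrable 0 a) ((continuous_Gs n s).intervalIntegrable 0 b)

/-- Convexity of `𝒢_s`: its graph lies above its tangents. -/
lemma Gs_mul_sub_le_GGs_sub (n : ℕ) (s a b : ℝ) :
    Gs n s b * (a - b) ≤ GGs n s a - GGs n s b := by
  rw [GGs_sub]
  have hi : ∀ a b, IntervalIntegrable (Gs n s) volume a b :=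
    fun a b => (continuous_Gs n s).intervalIntegrable a b
  rcases le_total b a with h | h
  · have := intervalIntegral.integral_mono_on h
      (intervalIntegrable_const (c := Gs n s b)) (hi b a)
      fun t ht => monotone_Gs n s ht.1
    simpa [mul_comm] using this
  · have := intervalIntegral.integral_mono_on h (hi a b)
      (intervalIntegrable_const (c := Gs n s b))
      fun t ht => monotone_Gs n s ht.2
    rw [intervalIntegral.integral_symm]
    simp only [intervalIntegral.integral_const, smul_eq_mul] at this
    linarith

lemma abs_GGs_sub_le {n : ℕ} (hn : 1 ≤ n) {s : ℝ} (hs : 0 < s) (a b : ℝ) :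
    |GGs n s a - GGs n s b| ≤ (∫ τ, gs n s τ) * |a - b| := by
  rw [GGs_sub]
  exact intervalIntegral.norm_integral_le_of_norm_le_const (f := Gs n s) fun t _ => abs_Gs_le hn hs t

/-! ### The kernel of `ℝⁿ⁺¹` -/

/-- The kernel `|Y|^{-(n+1+s)}` of `ℝⁿ⁺¹ = ℝⁿ × ℝ`. -/
def kern (n : ℕ) (s : ℝ) (z : Rn n × ℝ) : ℝ :=
  (‖z.1‖ ^ 2 + z.2 ^ 2) ^ (-(((n : ℝ) + 1 + s) / 2))

lemma kern_nonneg (n : ℕ) (s : ℝ) (z : Rn n × ℝ) : 0 ≤ kern n s z := by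
  unfold kern; positivity

lemma kern_neg (n : ℕ) (s : ℝ) (z : Rn n × ℝ) : kern n s (-z) = kern n s z := by
  simp [kern]

lemma measurable_kern (n : ℕ) (s : ℝ) : Measurable (kern n s) := by
  unfold kern; fun_prop

lemma kern_eq_gs {n : ℕ} {s : ℝ} {y : Rn n} (hy : y ≠ 0) (h : ℝ) :
    kern n s (y, h) = ‖y‖ ^ (-((n : ℝ) + 1 + s)) * gs n s (h / ‖y‖) := by
  have hd : 0 < ‖y‖ := norm_pos_iff.2 hy
  have e : ‖y‖ ^ 2 + h ^ 2 = ‖y‖ ^ 2 * (1 + (h / ‖y‖) ^ 2) := by field_simp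
  unfold kern gs
  simp only
  rw [e, Real.mul_rpow (by positivity) (by positivity), ← Real.rpow_natCast ‖y‖ 2,
    ← Real.rpow_mul hd.le, one_div, ← Real.rpow_neg (by positivity)]
  congr 2
  push_cast; ring

lemma integrable_kern_right {n : ℕ} (hn : 1 ≤ n) {s : ℝ} (hs : 0 < s) {y : Rn n} (hy : y ≠ 0) :
    Integrable fun h : ℝ => kern n s (y, h) := by
  simp_rw [kern_eq_gs hy]
  exact ((integrable_gs hn hs).comp_div (norm_ne_zero_iff.2 hy)).const_mul _

/-- `G_s(a/|y|) |y|^{-(n+s)}` is the integral of the kernel of `ℝⁿ⁺¹` over the part of the vertical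
line through `y` that lies between the heights `0` and `a`. -/
lemma Gs_div_eq {n : ℕ} {s : ℝ} {y : Rn n} (hy : y ≠ 0) (a : ℝ) :
    Gs n s (a / ‖y‖) / ‖y‖ ^ ((n : ℝ) + s) = ∫ h in (0 : ℝ)..a, kern n s (y, h) := by
  have hd : 0 < ‖y‖ := norm_pos_iff.2 hy
  simp_rw [kern_eq_gs hy]
  rw [intervalIntegral.integral_const_mul, intervalIntegral.integral_comp_div _ hd.ne', zero_div,
    smul_eq_mul, ← mul_assoc]
  have : ‖y‖ ^ (-((n : ℝ) + 1 + s)) * ‖y‖ = (‖y‖ ^ ((n : ℝ) + s))⁻¹ := by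
    rw [← Real.rpow_neg hd.le]
    nth_rw 2 [← Real.rpow_one ‖y‖]
    rw [← Real.rpow_add hd]
    congr 1; ring
  rw [this, Gs, div_eq_inv_mul]

/-- The flux `G_s(a/|y|) |y|^{-(n+s)}` as the integral of the kernel over a half-line, up to the
constant that makes it odd in `a`. -/
lemma Gs_div_eq_Iic {n : ℕ} (hn : 1 ≤ n) {s : ℝ} (hs : 0 < s) {y : Rn n} (hy : y ≠ 0) (a : ℝ) :
    Gs n s (a / ‖y‖) / ‖y‖ ^ ((n : ℝ) + s) =
      (∫ h in Set.Iic a, kern n s (y, h)) - (∫ h, kern n s (y, h)) / 2 := by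
  have hi := integrable_kern_right hn hs hy
  rw [Gs_div_eq hy, ← intervalIntegral.integral_Iic_sub_Iic hi.integrableOn hi.integrableOn]
  have h1 := integral_comp_neg_Iic (0 : ℝ) fun h => kern n s (y, h)
  have h2 : ∀ h : ℝ, kern n s (y, -h) = kern n s (y, h) := fun h => by simp [kern]
  simp only [h2, neg_zero] at h1
  have h3 := intervalIntegral.integral_Iic_add_Ioi (b := (0:ℝ)) hi.integrableOn hi.integrableOn
  linarith

/-! ### Interaction with the region between two touching balls -/

instance isAddHaarMeasure_volume (n : ℕ) : (volume : Measure (Rn n × ℝ)).IsAddHaarMeasure :=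
  inferInstanceAs (((volume : Measure (Rn n)).prod (volume : Measure ℝ)).IsAddHaarMeasure)

lemma norm_le_sqrt_sq_add_sq {n : ℕ} (z : Rn n × ℝ) : ‖z‖ ≤ √(‖z.1‖ ^ 2 + z.2 ^ 2) := by
  rw [Prod.norm_def, Real.norm_eq_abs]
  exact max_le (Real.le_sqrt_of_sq_le (by nlinarith [sq_nonneg z.2]))
    (Real.abs_le_sqrt (by nlinarith [sq_nonneg ‖z.1‖]))

/-- The part at distance about `a` from the origin of the region between two balls of radius `r`
that touch there from opposite sides has measure at most `C a^{n+2} / r` if `a ≤ r`: about `r / a`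
translates of it along the common normal `(p, c)` are disjoint and contained in a ball of radius
`12 a`. -/
lemma volume_slab_le (n : ℕ) : ∃ C : ℝ, 0 < C ∧ ∀ (r a c : ℝ) (p : Rn n), 0 < a → 0 < r →
    ‖p‖ ^ 2 + c ^ 2 = r ^ 2 →
    volume {z : Rn n × ℝ | ‖z.1‖ ^ 2 + z.2 ^ 2 < (2 * a) ^ 2 ∧
        2 * |⟪p, z.1⟫ + c * z.2| ≤ ‖z.1‖ ^ 2 + z.2 ^ 2} ≤
      ENNReal.ofReal (C * a ^ (n + 1) * min 1 (a / r)) := by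
  set ω := (volume (Metric.ball (0 : Rn n × ℝ) 1)) with hω
  have hω0 : ω ≠ 0 := (Metric.measure_ball_pos volume _ one_pos).ne'
  have hωt : ω ≠ ⊤ := measure_ball_lt_top.ne
  have hωr : 0 < ω.toReal := ENNReal.toReal_pos hω0 hωt
  have hball : ∀ a : ℝ, 0 < a → volume (Metric.ball (0 : Rn n × ℝ) (12 * a)) =
      ENNReal.ofReal (12 ^ (n + 1) * ω.toReal * a ^ (n + 1)) := by
    intro a ha
    rw [Measure.addHaar_ball _ _ (by positivity), ← hω, ← ENNReal.ofReal_toReal hωt,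
      ← ENNReal.ofReal_mul (by positivity)]
    congr 1
    rw [ENNReal.toReal_ofReal hωr.le]
    simp [Module.finrank_prod]
    ring
  refine ⟨12 ^ (n + 1) * ω.toReal, by positivity, fun r a c p ha hr hpc => ?_⟩
  set L : Set (Rn n × ℝ) := {z | ‖z.1‖ ^ 2 + z.2 ^ 2 < (2 * a) ^ 2 ∧
        2 * |⟪p, z.1⟫ + c * z.2| ≤ ‖z.1‖ ^ 2 + z.2 ^ 2} with hL
  have hLm : MeasurableSet L := by
    refine MeasurableSet.inter (s₁ := {z : Rn n × ℝ | ‖z.1‖ ^ 2 + z.2 ^ 2 < (2 * a) ^ 2})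
      (s₂ := {z : Rn n × ℝ | 2 * |⟪p, z.1⟫ + c * z.2| ≤ ‖z.1‖ ^ 2 + z.2 ^ 2})
      (measurableSet_lt (by fun_prop) (by fun_prop)) (measurableSet_le (by fun_prop) (by fun_prop))
  have hnorm : ∀ z ∈ L, ‖z‖ < 2 * a := by
    intro z hz
    refine (norm_le_sqrt_sq_add_sq z).trans_lt ?_
    rw [Real.sqrt_lt' (by positivity)]
    exact hz.1
  rcases le_total r a with hra | har
  · rw [min_eq_left ((one_le_div hr).2 hra), mul_one, ← hball a ha]
    refine measure_mono fun z hz => ?_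
    rw [mem_ball_zero_iff]
    linarith [hnorm z hz]
  rw [min_eq_right ((div_le_one hr).2 har)]
  set N := ⌈r / a⌉₊ with hN
  have hN1 : r / a ≤ N := Nat.le_ceil _
  have hN2 : (N : ℝ) < r / a + 1 := Nat.ceil_lt_add_one (by positivity)
  set e : Rn n × ℝ := (5 * a ^ 2 / r ^ 2) • (p, c) with he
  have hl : ∀ (z : Rn n × ℝ) (j : ℕ), ⟪p, ((j : ℝ) • e + z).1⟫ + c * ((j : ℝ) • e + z).2 =
      j * (5 * a ^ 2) + (⟪p, z.1⟫ + c * z.2) := by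
    intro z j
    simp only [he, Prod.fst_add, Prod.snd_add, Prod.smul_fst, Prod.smul_snd, inner_add_right,
      inner_smul_right, real_inner_self_eq_norm_sq, smul_eq_mul]
    have : ‖p‖ ^ 2 = r ^ 2 - c ^ 2 := by linarith
    rw [this]
    field_simp
    ring
  have hlL : ∀ z ∈ L, |⟪p, z.1⟫ + c * z.2| < 2 * a ^ 2 := fun z hz => by
    nlinarith [hz.1, hz.2]
  have hdis : Set.PairwiseDisjoint (↑(Finset.range N))
      (fun j : ℕ => (fun z => (j : ℝ) • e + z) ⁻¹' L) := by
    intro i _ j _ hij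
    refine Set.disjoint_left.2 fun z hz hz' => hij ?_
    have h1 := abs_lt.1 (hlL _ hz)
    have h2 := abs_lt.1 (hlL _ hz')
    rw [hl] at h1 h2
    have ha2 : 0 < a ^ 2 := by positivity
    have h3 : (i : ℝ) < j + 1 := by nlinarith
    have h4 : (j : ℝ) < i + 1 := by nlinarith
    have h5 : i < j + 1 := by exact_mod_cast h3
    have h6 : j < i + 1 := by exact_mod_cast h4
    omega
  have hsub : (⋃ j ∈ Finset.range N, (fun z => (j : ℝ) • e + z) ⁻¹' L) ⊆
      Metric.ball (0 : Rn n × ℝ) (12 * a) := by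
    intro z hz
    simp only [Set.mem_iUnion, Finset.mem_range, Set.mem_preimage, exists_prop] at hz
    obtain ⟨j, hj, hz⟩ := hz
    rw [mem_ball_zero_iff]
    have hpc' : ‖(p, c)‖ ≤ r := by
      refine (norm_le_sqrt_sq_add_sq (p, c)).trans ?_
      rw [hpc, Real.sqrt_sq hr.le]
    have hje : ‖(j : ℝ) • e‖ ≤ 10 * a := by
      rw [he, norm_smul, norm_smul, Real.norm_of_nonneg (by positivity),
        Real.norm_of_nonneg (by positivity)]
      have hjN : (j : ℝ) ≤ r / a + 1 := by
        have : (j : ℝ) < N := by exact_mod_cast hj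
        linarith
      calc (j : ℝ) * (5 * a ^ 2 / r ^ 2 * ‖(p, c)‖)
          ≤ (r / a + 1) * (5 * a ^ 2 / r ^ 2 * r) := by gcongr
        _ = 5 * a + 5 * a * (a / r) := by field_simp
        _ ≤ 5 * a + 5 * a * 1 := by
            gcongr
            exact (div_le_one hr).2 har
        _ = 10 * a := by ring
    have h1 : ‖z‖ ≤ ‖(j : ℝ) • e + z‖ + ‖(j : ℝ) • e‖ := by
      have := norm_sub_le ((j : ℝ) • e + z) ((j : ℝ) • e)
      simpa using this
    linarith [hnorm _ hz]
  have hmeas := measure_mono (μ := volume) hsub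
  rw [measure_biUnion_finset hdis fun j _ => (measurable_const_add _) hLm, hball a ha] at hmeas
  simp only [measure_preimage_add, Finset.sum_const, Finset.card_range, nsmul_eq_mul] at hmeas
  have hra : 0 < r / a := by positivity
  calc volume L = ENNReal.ofReal (a / r) * (ENNReal.ofReal (r / a) * volume L) := by
        rw [← mul_assoc, ← ENNReal.ofReal_mul (by positivity)]
        have : a / r * (r / a) = 1 := by field_simp
        rw [this, ENNReal.ofReal_one, one_mul]
    _ ≤ ENNReal.ofReal (a / r) * ENNReal.ofReal (12 ^ (n + 1) * ω.toReal * a ^ (n + 1)) := by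
        gcongr
        refine le_trans ?_ hmeas
        gcongr
        rw [← ENNReal.ofReal_natCast]
        exact ENNReal.ofReal_le_ofReal hN1
    _ = _ := by
        rw [← ENNReal.ofReal_mul (by positivity), mul_comm]

/-- The flux that is lost to the region between two balls of radius `r` touching at the origin is
at most `C r^{-s}`, whatever the direction of the common normal. -/
lemma lintegral_kern_le (n : ℕ) {s : ℝ} (hs0 : 0 < s) (hs1 : s < 1) :
    ∃ C : ℝ, 0 < C ∧ ∀ (r c : ℝ) (p : Rn n), 0 < r → ‖p‖ ^ 2 + c ^ 2 = r ^ 2 →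
    ∫⁻ z in {z : Rn n × ℝ | 2 * |⟪p, z.1⟫ + c * z.2| ≤ ‖z.1‖ ^ 2 + z.2 ^ 2},
      ENNReal.ofReal (kern n s z) ≤ ENNReal.ofReal (C * r ^ (-s)) := by
  obtain ⟨C, hC, hslab⟩ := volume_slab_le n
  set f : ℤ → ℝ := fun j => ((2 : ℝ) ^ j) ^ (-s) * min 1 ((2 : ℝ) ^ j) with hf
  have hf0 : ∀ j, 0 < f j := fun j => by
    have : (0 : ℝ) < 2 ^ j := by positivity
    simp only [hf]; positivity
  have hfs : Summable f := by
    refine Summable.of_nat_of_neg ?_ ?_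
    · refine Summable.of_nonneg_of_le (fun j => (hf0 _).le) (fun j => ?_)
        (summable_geometric_of_lt_one (r := (2 : ℝ) ^ (-s)) (by positivity)
          (Real.rpow_lt_one_of_one_lt_of_neg (by norm_num) (by linarith)))
      simp only [hf, zpow_natCast]
      rw [← Real.rpow_natCast_mul (by norm_num), mul_comm (j : ℝ), Real.rpow_mul_natCast (by norm_num)]
      exact mul_le_of_le_one_right (by positivity) (min_le_left _ _)
    · refine Summable.of_nonneg_of_le (fun j => (hf0 _).le) (fun j => ?_)
        (summable_geometric_of_lt_one (r := (2 : ℝ) ^ (s - 1)) (by positivity)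
          (Real.rpow_lt_one_of_one_lt_of_neg (by norm_num) (by linarith)))
      simp only [hf]
      have e1 : ((2 : ℝ) ^ (-(j : ℤ))) = (2 : ℝ) ^ (-(j : ℝ)) := by
        rw [Real.rpow_neg (by norm_num), Real.rpow_natCast, zpow_neg, zpow_natCast]
      rw [e1]
      calc ((2 : ℝ) ^ (-(j : ℝ))) ^ (-s) * min 1 ((2 : ℝ) ^ (-(j : ℝ)))
          ≤ ((2 : ℝ) ^ (-(j : ℝ))) ^ (-s) * (2 : ℝ) ^ (-(j : ℝ)) := by
            gcongr; exact min_le_right _ _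
        _ = ((2 : ℝ) ^ (s - 1)) ^ j := by
            rw [← Real.rpow_mul (by norm_num), ← Real.rpow_add (by norm_num),
              ← Real.rpow_mul_natCast (by norm_num)]
            congr 1; ring
  have hfpos : 0 < ∑' j, f j := hfs.tsum_pos (fun j => (hf0 j).le) 0 (hf0 0)
  refine ⟨C * ∑' j, f j, by positivity, fun r c p hr hpc => ?_⟩
  set a : ℤ → ℝ := fun j => (2 : ℝ) ^ j * r with ha
  have ha0 : ∀ j, 0 < a j := fun j => by simp only [ha]; positivity
  set L : Set (Rn n × ℝ) := {z | 2 * |⟪p, z.1⟫ + c * z.2| ≤ ‖z.1‖ ^ 2 + z.2 ^ 2} with hL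
  set S : ℤ → Set (Rn n × ℝ) := fun j => {z | (a j) ^ 2 ≤ ‖z.1‖ ^ 2 + z.2 ^ 2} ∩
    {z | ‖z.1‖ ^ 2 + z.2 ^ 2 < (2 * a j) ^ 2 ∧
        2 * |⟪p, z.1⟫ + c * z.2| ≤ ‖z.1‖ ^ 2 + z.2 ^ 2} with hS
  have hcov : L ⊆ {0} ∪ ⋃ j, S j := by
    intro z hz
    rcases eq_or_ne z 0 with h0 | h0
    · exact Or.inl h0
    right
    have hq : 0 < √(‖z.1‖ ^ 2 + z.2 ^ 2) :=
      (norm_pos_iff.2 h0).trans_le (norm_le_sqrt_sq_add_sq z)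
    obtain ⟨j, hj1, hj2⟩ := exists_mem_Ico_zpow (x := √(‖z.1‖ ^ 2 + z.2 ^ 2) / r) (y := 2)
      (by positivity) (by norm_num)
    rw [le_div_iff₀ hr] at hj1
    rw [div_lt_iff₀ hr, zpow_add_one₀ (by norm_num)] at hj2
    refine Set.mem_iUnion.2 ⟨j, ?_, ?_, hz⟩
    · exact (Real.le_sqrt (ha0 j).le (by positivity)).1 hj1
    · refine (Real.sqrt_lt' (by have := ha0 j; positivity)).1 ?_
      simp only [ha]; linarith
  have hpiece : ∀ j, ∫⁻ z in S j, ENNReal.ofReal (kern n s z) ≤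
      ENNReal.ofReal (C * r ^ (-s) * f j) := by
    intro j
    have haj := ha0 j
    calc ∫⁻ z in S j, ENNReal.ofReal (kern n s z)
        ≤ ∫⁻ z in S j, ENNReal.ofReal ((a j) ^ (-((n : ℝ) + 1 + s))) := by
          refine setLIntegral_mono (by fun_prop) fun z hz => ENNReal.ofReal_le_ofReal ?_
          have : (a j) ^ (-((n : ℝ) + 1 + s)) = ((a j) ^ 2) ^ (-(((n : ℝ) + 1 + s) / 2)) := by
            rw [← Real.rpow_natCast_mul haj.le]
            congr 1; push_cast; ring
          rw [this]
          unfold kern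
          have hn0 : (0 : ℝ) ≤ n := n.cast_nonneg
          exact Real.rpow_le_rpow_of_nonpos (by positivity) hz.1 (by linarith)
      _ = ENNReal.ofReal ((a j) ^ (-((n : ℝ) + 1 + s))) * volume (S j) := by
          rw [setLIntegral_const]
      _ ≤ ENNReal.ofReal ((a j) ^ (-((n : ℝ) + 1 + s))) *
          ENNReal.ofReal (C * (a j) ^ (n + 1) * min 1 (a j / r)) := by
          gcongr
          exact (measure_mono Set.inter_subset_right).trans (hslab r (a j) c p haj hr hpc)
      _ = ENNReal.ofReal (C * r ^ (-s) * f j) := by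
          rw [← ENNReal.ofReal_mul (by positivity)]
          congr 1
          have e1 : (a j) ^ (-((n : ℝ) + 1 + s)) * (a j) ^ (n + 1) = (a j) ^ (-s) := by
            rw [← Real.rpow_natCast, ← Real.rpow_add haj]
            congr 1; push_cast; ring
          have e2 : a j / r = 2 ^ j := by simp only [ha]; field_simp
          have e3 : (a j) ^ (-s) = ((2 : ℝ) ^ j) ^ (-s) * r ^ (-s) :=
            Real.mul_rpow (by positivity) hr.le
          rw [e2]
          calc _ = C * ((a j) ^ (-((n : ℝ) + 1 + s)) * (a j) ^ (n + 1)) * min 1 ((2 : ℝ) ^ j) := by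
                ring
            _ = _ := by rw [e1, e3]; simp only [hf]; ring
  calc ∫⁻ z in L, ENNReal.ofReal (kern n s z)
      ≤ ∫⁻ z in {0} ∪ ⋃ j, S j, ENNReal.ofReal (kern n s z) := lintegral_mono_set hcov
    _ ≤ (∫⁻ z in {0}, ENNReal.ofReal (kern n s z)) +
          ∫⁻ z in ⋃ j, S j, ENNReal.ofReal (kern n s z) := lintegral_union_le _ _ _
    _ = ∫⁻ z in ⋃ j, S j, ENNReal.ofReal (kern n s z) := by
        rw [setLIntegral_measure_zero _ _ (measure_singleton _), zero_add]
    _ ≤ ∑' j, ENNReal.ofReal (C * r ^ (-s) * f j) :=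
        (lintegral_iUnion_le _ _).trans (ENNReal.tsum_le_tsum hpiece)
    _ = ENNReal.ofReal (C * (∑' j, f j) * r ^ (-s)) := by
        rw [← ENNReal.ofReal_tsum_of_nonneg (fun j => by have := hf0 j; positivity)
          (hfs.mul_left _), tsum_mul_left]
        congr 1; ring

/-- The kernel restricted to `{|y| > τ}`, which is integrable on `ℝⁿ⁺¹`. -/
def truncKern (n : ℕ) (s τ : ℝ) (z : Rn n × ℝ) : ℝ :=
  {z : Rn n × ℝ | τ < ‖z.1‖}.indicator (kern n s) z

lemma truncKern_nonneg (n : ℕ) (s τ : ℝ) (z : Rn n × ℝ) : 0 ≤ truncKern n s τ z :=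
  Set.indicator_nonneg (fun z _ => kern_nonneg n s z) z

lemma truncKern_le (n : ℕ) (s τ : ℝ) (z : Rn n × ℝ) : truncKern n s τ z ≤ kern n s z :=
  Set.indicator_le_self' (fun z _ => kern_nonneg n s z) z

lemma truncKern_neg (n : ℕ) (s τ : ℝ) (z : Rn n × ℝ) :
    truncKern n s τ (-z) = truncKern n s τ z := by
  simp [truncKern, Set.indicator_apply, kern_neg]

lemma truncKern_of_lt {n : ℕ} {s τ : ℝ} {z : Rn n × ℝ} (h : τ < ‖z.1‖) :
    truncKern n s τ z = kern n s z :=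
  Set.indicator_of_mem (s := {z : Rn n × ℝ | τ < ‖z.1‖}) h _

lemma measurable_truncKern (n : ℕ) (s τ : ℝ) : Measurable (truncKern n s τ) :=
  (measurable_kern n s).indicator (measurableSet_lt (by fun_prop) (by fun_prop))

lemma integrable_truncKern (n : ℕ) {s τ : ℝ} (hs : 0 < s) (hτ : 0 < τ) :
    Integrable (truncKern n s τ) := by
  have hn0 : (0 : ℝ) ≤ n := n.cast_nonneg
  have h := integrable_one_add_norm (E := Rn n × ℝ) (μ := volume) (r := (n : ℝ) + 1 + s)
    (by simp [Module.finrank_prod]; linarith)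
  refine (h.const_mul ((1 / τ + 1) ^ ((n : ℝ) + 1 + s))).mono'
    (measurable_truncKern n s τ).aestronglyMeasurable (ae_of_all _ fun z => ?_)
  rw [Real.norm_of_nonneg (truncKern_nonneg n s τ z)]
  by_cases hz : τ < ‖z.1‖
  · rw [truncKern_of_lt hz]
    have hq : 0 < ‖z.1‖ ^ 2 + z.2 ^ 2 := by have := hτ.trans hz; positivity
    set m := √(‖z.1‖ ^ 2 + z.2 ^ 2) with hm
    have hm0 : 0 < m := Real.sqrt_pos.2 hq
    have hτm : τ ≤ m := by
      refine hz.le.trans (Real.le_sqrt_of_sq_le (by nlinarith [sq_nonneg z.2]))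
    have e : kern n s z = m ^ (-((n : ℝ) + 1 + s)) := by
      unfold kern
      rw [← Real.sq_sqrt hq.le, ← hm, ← Real.rpow_natCast_mul hm0.le]
      congr 1; push_cast; ring
    have hle : 1 + ‖z‖ ≤ (1 / τ + 1) * m := by
      have h1 : 1 ≤ 1 / τ * m := by rw [one_div, ← div_eq_inv_mul]; exact (one_le_div hτ).2 hτm
      linarith [norm_le_sqrt_sq_add_sq z]
    have hpos : 0 < 1 / τ + 1 := by positivity
    rw [e]
    calc m ^ (-((n : ℝ) + 1 + s))
        = (1 / τ + 1) ^ ((n : ℝ) + 1 + s) * ((1 / τ + 1) * m) ^ (-((n : ℝ) + 1 + s)) := by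
          rw [Real.mul_rpow hpos.le hm0.le, ← mul_assoc, ← Real.rpow_add hpos]
          simp
      _ ≤ _ := by
          gcongr ?_ * ?_
          exact Real.rpow_le_rpow_of_nonpos (by positivity) hle (by linarith)
  · rw [truncKern, Set.indicator_of_notMem (by exact hz)]
    positivity

/-! ### The flux through a point of the barrier -/

/-- The flux `∫_{|y| > τ} G_s(a(y)/|y|) |y|^{-(n+s)} dy` through a point of the graph of the
barrier, which is placed at the origin of `ℝⁿ⁺¹`. The vertical coordinate `h` is measured downwards,
so that `h ≤ a y` describes the region above the graph. The last two hypotheses say that this region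
contains the ball with centre `-(p, c)` and radius `r`, which touches the origin, and near the
origin everything outside a cylinder over a set `T` of small measure. -/
lemma flux_lower_bound {n : ℕ} (hn : 1 ≤ n) {s : ℝ} (hs0 : 0 < s) (hs1 : s < 1) :
    ∃ c₁ C₂ : ℝ, 0 < c₁ ∧ 0 < C₂ ∧ ∀ (r c ρ τ : ℝ) (p : Rn n) (T : Set (Rn n)) (a : Rn n → ℝ),
      0 < r → ‖p‖ ^ 2 + c ^ 2 = r ^ 2 → 0 < ρ → 0 < τ → τ < ρ / 2 → MeasurableSet T →
      volume T ≤ ENNReal.ofReal (ρ ^ n / 8) * volume (Metric.ball (0 : Rn n) 1) →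
      AEMeasurable a →
      (∀ y h, ‖y‖ ^ 2 + h ^ 2 + 2 * (⟪p, y⟫ + c * h) < 0 → h ≤ a y) →
      (∀ y, y ∉ T → ‖y‖ < ρ → ρ ≤ a y) →
      c₁ * ρ ^ (-s) - C₂ * r ^ (-s) ≤
        ∫ y, {y : Rn n | τ < ‖y‖}.indicator
          (fun y => Gs n s (a y / ‖y‖) / ‖y‖ ^ ((n : ℝ) + s)) y := by
  have : Nonempty (Fin n) := ⟨⟨0, hn⟩⟩
  obtain ⟨C, hC, hloss⟩ := lintegral_kern_le n hs0 hs1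
  set ω := (volume (Metric.ball (0 : Rn n) 1)) with hω
  have hω0 : ω ≠ 0 := (Metric.measure_ball_pos volume _ one_pos).ne'
  have hωt : ω ≠ ⊤ := measure_ball_lt_top.ne
  have hωr : 0 < ω.toReal := ENNReal.toReal_pos hω0 hωt
  set P : ℝ := ((n : ℝ) + 1 + s) / 2 with hP
  have hn0 : (0 : ℝ) ≤ n := n.cast_nonneg
  have hP0 : 0 < P := by rw [hP]; linarith
  refine ⟨2 ^ (-P) * (ω.toReal / 4), C / 2, by positivity, by positivity, ?_⟩
  intro r c ρ τ p T a hr hpc hρ hτ hτρ hTm hT ha hball haT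
  set K := truncKern n s τ with hK
  have hKi : Integrable K := integrable_truncKern n hs0 hτ
  have hKm : Measurable K := measurable_truncKern n s τ
  have hK0 : ∀ z, 0 ≤ K z := truncKern_nonneg n s τ
  set B : Set (Rn n × ℝ) := {z | ‖z.1‖ ^ 2 + z.2 ^ 2 + 2 * (⟪p, z.1⟫ + c * z.2) < 0} with hB
  set L : Set (Rn n × ℝ) := {z | 2 * |⟪p, z.1⟫ + c * z.2| ≤ ‖z.1‖ ^ 2 + z.2 ^ 2} with hL
  have hBm : MeasurableSet B := measurableSet_lt (by fun_prop) (by fun_prop)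
  have hLm : MeasurableSet L := measurableSet_le (by fun_prop) (by fun_prop)
  have hLK : ∫ z in L, K z ≤ C * r ^ (-s) := by
    rw [integral_eq_lintegral_of_nonneg_ae (ae_of_all _ hK0) hKm.aestronglyMeasurable]
    refine ENNReal.toReal_le_of_le_ofReal (by positivity) ?_
    exact (lintegral_mono fun z => ENNReal.ofReal_le_ofReal (truncKern_le n s τ z)).trans
      (hloss r c p hr hpc)
  have hBneg : ∀ z ∈ B, -z ∉ B := by
    intro z hz hz'
    simp only [hB, Set.mem_ofPred_eq, Prod.fst_neg, Prod.snd_neg, norm_neg, inner_neg_right] at hz hz'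
    nlinarith [sq_nonneg ‖z.1‖, sq_nonneg z.2]
  -- `B` and `-B` are disjoint, carry the same mass, and `L` is what they leave out.
  have hBK : (∫ z, K z) / 2 - C / 2 * r ^ (-s) ≤ ∫ z in B, K z := by
    have e1 : ∫ z in Bᶜ, K z = (∫ z in (fun z => -z) ⁻¹' B, K z) + ∫ z in L, K z := by
      rw [← setIntegral_union _ hLm hKi.integrableOn hKi.integrableOn]
      · congr 2
        ext z
        simp only [hB, hL, Set.mem_compl_iff, Set.mem_union, Set.mem_preimage, Set.mem_ofPred_eq,
          Prod.fst_neg, Prod.snd_neg, norm_neg, inner_neg_right, not_lt]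
        constructor
        · intro h
          by_cases h2 : ‖z.1‖ ^ 2 + (-z.2) ^ 2 + 2 * (-⟪p, z.1⟫ + c * -z.2) < 0
          · exact Or.inl h2
          · right
            rw [← abs_two, ← abs_mul, abs_le]
            constructor <;> nlinarith
        · rintro (h | h)
          · nlinarith [sq_nonneg ‖z.1‖, sq_nonneg z.2]
          · have := neg_abs_le (⟪p, z.1⟫ + c * z.2)
            linarith
      · refine Set.disjoint_left.2 fun z hz hz' => ?_
        simp only [hB, hL, Set.mem_preimage, Set.mem_ofPred_eq,
          Prod.fst_neg, Prod.snd_neg, norm_neg, inner_neg_right] at hz hz'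
        have := le_abs_self (⟪p, z.1⟫ + c * z.2)
        nlinarith
    have e2 : ∫ z in (fun z => -z) ⁻¹' B, K z = ∫ z in B, K z := by
      have := (Measure.measurePreserving_neg (volume : Measure (Rn n × ℝ))).setIntegral_preimage_emb
        (MeasurableEquiv.neg (Rn n × ℝ)).measurableEmbedding K B
      rw [← this]
      exact setIntegral_congr_fun (measurable_neg hBm) fun z _ => (truncKern_neg n s τ z).symm
    have e3 := integral_add_compl hBm hKi
    rw [e1, e2] at e3
    linarith
  -- The box shell, on which the kernel is at least `(2 ρ²) ^ (-P)`.
  set S : Set (Rn n × ℝ) :=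
    (Metric.ball (0 : Rn n) ρ \ Metric.ball (0 : Rn n) (ρ / 2)) ×ˢ Set.Ioo (-ρ) ρ with hS
  have hSm : MeasurableSet S :=
    (measurableSet_ball.diff measurableSet_ball).prod measurableSet_Ioo
  set U : Set (Rn n × ℝ) := (S \ T ×ˢ Set.univ) \ B with hU
  have hUm : MeasurableSet U := (hSm.diff (hTm.prod MeasurableSet.univ)).diff hBm
  have hbv : ∀ t : ℝ, 0 < t → volume (Metric.ball (0 : Rn n) t) = ENNReal.ofReal (t ^ n) * ω := by
    intro t ht
    rw [Measure.addHaar_ball _ _ ht.le, finrank_euclideanSpace_fin]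
  have hSfin : volume S ≠ ⊤ := by
    rw [hS, Measure.volume_eq_prod, Measure.prod_prod]
    refine ENNReal.mul_ne_top (measure_ne_top_of_subset Set.sdiff_subset measure_ball_lt_top.ne) ?_
    simp
  have hSv : ω.toReal * ρ ^ (n + 1) ≤ volume.real S := by
    have h1 : volume.real S = (ρ ^ n * ω.toReal - (ρ / 2) ^ n * ω.toReal) * (2 * ρ) := by
      rw [hS, Measure.real, Measure.volume_eq_prod, Measure.prod_prod,
        measure_sdiff (Metric.ball_subset_ball (by linarith)) measurableSet_ball.nullMeasurableSet
          measure_ball_lt_top.ne, hbv _ hρ, hbv _ (by positivity), ENNReal.toReal_mul,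
        ENNReal.toReal_sub_of_le _ (ENNReal.mul_ne_top ENNReal.ofReal_ne_top hωt),
        ENNReal.toReal_mul, ENNReal.toReal_mul, ENNReal.toReal_ofReal (by positivity),
        ENNReal.toReal_ofReal (by positivity), Real.volume_Ioo, ENNReal.toReal_ofReal (by linarith)]
      · ring
      · gcongr; linarith
    have h2 : (ρ / 2) ^ n ≤ ρ ^ n / 2 := by
      rw [div_pow]
      gcongr
      calc (2 : ℝ) = 2 ^ 1 := (pow_one _).symm
        _ ≤ 2 ^ n := pow_le_pow_right₀ (by norm_num) hn
    rw [h1]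
    calc ω.toReal * ρ ^ (n + 1) = (ρ ^ n * ω.toReal - ρ ^ n / 2 * ω.toReal) * (2 * ρ) := by ring
      _ ≤ _ := by gcongr
  have hUv : ω.toReal * ρ ^ (n + 1) / 4 ≤ volume.real U := by
    have h1 : volume.real S ≤ volume.real (S \ B) + volume.real (S \ B) := by
      have hneg : volume.real ((fun z => -z) ⁻¹' (S \ B)) = volume.real (S \ B) := by
        rw [Measure.real, Measure.real]
        congr 1
        exact (Measure.measurePreserving_neg (volume : Measure (Rn n × ℝ))).measure_preimage
          (hSm.diff hBm).nullMeasurableSet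
      have hfin : volume (S \ B) ≠ ⊤ := measure_ne_top_of_subset Set.sdiff_subset hSfin
      have hfin' : volume ((fun z => -z) ⁻¹' (S \ B)) ≠ ⊤ := by
        rw [(Measure.measurePreserving_neg (volume : Measure (Rn n × ℝ))).measure_preimage
          (hSm.diff hBm).nullMeasurableSet]
        exact hfin
      calc volume.real S ≤ volume.real ((S \ B) ∪ (fun z => -z) ⁻¹' (S \ B)) := by
            refine measureReal_mono (fun z hz => ?_) (measure_union_ne_top hfin hfin')
            by_cases h : z ∈ B
            · right
              refine ⟨?_, hBneg z h⟩
              simp only [hS, Set.mem_prod, Set.mem_sdiff, mem_ball_zero_iff, Set.mem_Ioo,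
                Prod.fst_neg, Prod.snd_neg, norm_neg] at hz ⊢
              exact ⟨hz.1, by linarith [hz.2.2], by linarith [hz.2.1]⟩
            · exact Or.inl ⟨hz, h⟩
        _ ≤ _ := measureReal_union_le _ _
        _ = _ := by rw [hneg]
    have hTfin : volume (T ×ˢ Set.Ioo (-ρ) ρ) ≤ ENNReal.ofReal (ω.toReal * ρ ^ (n + 1) / 4) := by
      rw [Measure.volume_eq_prod, Measure.prod_prod, Real.volume_Ioo]
      calc volume T * ENNReal.ofReal (ρ - -ρ)
          ≤ ENNReal.ofReal (ρ ^ n / 8) * ω * ENNReal.ofReal (ρ - -ρ) := by gcongr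
        _ = _ := by
          rw [← ENNReal.ofReal_toReal hωt, ← ENNReal.ofReal_mul (by positivity),
            ← ENNReal.ofReal_mul (by positivity)]
          congr 1
          rw [ENNReal.toReal_ofReal hωr.le]
          ring
    have h2 : volume.real (S \ B) ≤ volume.real U + volume.real (T ×ˢ Set.Ioo (-ρ) ρ) := by
      refine le_trans (measureReal_mono (fun z hz => ?_) (measure_union_ne_top
        (measure_ne_top_of_subset (Set.sdiff_subset.trans Set.sdiff_subset) hSfin)
        (ne_top_of_le_ne_top ENNReal.ofReal_ne_top hTfin))) (measureReal_union_le _ _)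
      by_cases h : z.1 ∈ T
      · exact Or.inr ⟨h, hz.1.2⟩
      · exact Or.inl ⟨⟨hz.1, fun h' => h h'.1⟩, hz.2⟩
    have h3 : volume.real (T ×ˢ Set.Ioo (-ρ) ρ) ≤ ω.toReal * ρ ^ (n + 1) / 4 :=
      ENNReal.toReal_le_of_le_ofReal (by positivity) hTfin
    linarith
  have hUK : 2 ^ (-P) * (ω.toReal / 4) * ρ ^ (-s) ≤ ∫ z in U, K z := by
    have hUfin : volume U ≠ ⊤ :=
      measure_ne_top_of_subset (Set.sdiff_subset.trans Set.sdiff_subset) hSfin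
    have h1 : ∫ z in U, (2 * ρ ^ 2) ^ (-P) ≤ ∫ z in U, K z := by
      refine setIntegral_mono_on (integrableOn_const hUfin) hKi.integrableOn hUm fun z hz => ?_
      have hz' := hz.1.1
      simp only [hS, Set.mem_prod, Set.mem_sdiff, mem_ball_zero_iff, Set.mem_Ioo, not_lt] at hz'
      obtain ⟨⟨h1, h2⟩, h3, h4⟩ := hz'
      rw [hK, truncKern_of_lt (by linarith)]
      unfold kern
      have : 0 < ‖z.1‖ := by linarith
      refine Real.rpow_le_rpow_of_nonpos (by positivity) ?_ (by linarith)
      nlinarith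
    rw [setIntegral_const, smul_eq_mul] at h1
    refine le_trans ?_ h1
    have e : (2 * ρ ^ 2) ^ (-P) = 2 ^ (-P) * ρ ^ (-s) * (ρ ^ (n + 1))⁻¹ := by
      rw [Real.mul_rpow (by norm_num) (by positivity), ← Real.rpow_natCast_mul hρ.le,
        ← Real.rpow_natCast, ← Real.rpow_neg hρ.le, mul_assoc, ← Real.rpow_add hρ]
      congr 2
      push_cast; rw [hP]; ring
    have hρn : ρ ^ (n + 1) ≠ 0 := by positivity
    calc 2 ^ (-P) * (ω.toReal / 4) * ρ ^ (-s)
        = ω.toReal * ρ ^ (n + 1) / 4 * (2 * ρ ^ 2) ^ (-P) := by rw [e]; field_simp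
      _ ≤ _ := by gcongr
  -- The part of the region above the graph that enters the estimate.
  set D : Set (Rn n × ℝ) := B ∪ U with hD
  have hDm : MeasurableSet D := hBm.union hUm
  have hDi : Integrable (D.indicator K) := hKi.indicator hDm
  have hDK : ∫ z in D, K z = (∫ z in B, K z) + ∫ z in U, K z :=
    setIntegral_union Set.disjoint_sdiff_right hUm hKi.integrableOn hKi.integrableOn
  have hDi' : Integrable (fun y : Rn n => ∫ h, D.indicator K (y, h)) :=
    Integrable.integral_prod_left hDi
  have hKi' : Integrable (fun y : Rn n => (∫ h, K (y, h)) / 2) :=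
    (Integrable.integral_prod_left hKi).div_const 2
  have hint : ∫ y : Rn n, ((∫ h, D.indicator K (y, h)) - (∫ h, K (y, h)) / 2) =
      (∫ z in D, K z) - (∫ z, K z) / 2 := by
    rw [integral_sub hDi' hKi', integral_div, ← integral_prod _ hDi, ← integral_prod _ hKi,
      ← Measure.volume_eq_prod, integral_indicator hDm]
  have hpt : ∀ y : Rn n, (∫ h, D.indicator K (y, h)) - (∫ h, K (y, h)) / 2 ≤
      {y : Rn n | τ < ‖y‖}.indicator (fun y => Gs n s (a y / ‖y‖) / ‖y‖ ^ ((n : ℝ) + s)) y := by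
    intro y
    by_cases hy : τ < ‖y‖
    · have hy0 : y ≠ 0 := norm_pos_iff.1 (hτ.trans hy)
      rw [Set.indicator_of_mem (by exact hy), Gs_div_eq_Iic hn hs0 hy0]
      have hKk : ∀ h, K (y, h) = kern n s (y, h) := fun h => truncKern_of_lt (by exact hy)
      have hki := integrable_kern_right hn hs0 hy0
      simp_rw [hKk]
      gcongr
      rw [← integral_indicator measurableSet_Iic]
      refine integral_mono_of_nonneg (ae_of_all _ fun h => Set.indicator_nonneg (fun z _ => hK0 z) _)
        (hki.indicator measurableSet_Iic) (ae_of_all _ fun h => ?_)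
      by_cases hD' : (y, h) ∈ D
      · simp only
        rw [Set.indicator_of_mem hD', Set.indicator_of_mem, hKk]
        rcases hD' with h' | h'
        · exact hball y h h'
        · have h1 := h'.1.1
          simp only [hS, Set.mem_prod, Set.mem_sdiff, mem_ball_zero_iff, Set.mem_Ioo] at h1
          exact h1.2.2.le.trans (haT y (fun hyT => h'.1.2 ⟨hyT, trivial⟩) h1.1.1)
      · simp only
        rw [Set.indicator_of_notMem hD']
        exact Set.indicator_nonneg (fun h _ => kern_nonneg n s _) _
    · have hK' : ∀ h, K (y, h) = 0 := fun h =>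
        Set.indicator_of_notMem (s := {z : Rn n × ℝ | τ < ‖z.1‖}) (by exact hy) _
      have hK'' : ∀ h, D.indicator K (y, h) = 0 := fun h => by
        simp [hK']
      rw [Set.indicator_of_notMem (by exact hy)]
      simp [hK', hK'']
  have hflux : Integrable ({y : Rn n | τ < ‖y‖}.indicator
      (fun y => Gs n s (a y / ‖y‖) / ‖y‖ ^ ((n : ℝ) + s))) := by
    have hm : AEMeasurable (fun y => Gs n s (a y / ‖y‖) / ‖y‖ ^ ((n : ℝ) + s)) :=
      ((continuous_Gs n s).measurable.comp_aemeasurable (ha.div (by fun_prop))).div (by fun_prop)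
    have hset : MeasurableSet {y : Rn n | τ < ‖y‖} := measurableSet_lt (by fun_prop) (by fun_prop)
    refine (Integrable.integral_prod_left hKi).mono' (hm.indicator hset).aestronglyMeasurable
      (ae_of_all _ fun y => ?_)
    by_cases hy : τ < ‖y‖
    · have hy0 : y ≠ 0 := norm_pos_iff.1 (hτ.trans hy)
      rw [Set.indicator_of_mem (by exact hy), Gs_div_eq hy0]
      have hKk : ∀ h, K (y, h) = kern n s (y, h) := fun h => truncKern_of_lt (by exact hy)
      simp_rw [hKk]
      refine (intervalIntegral.norm_integral_le_integral_norm_uIoc).trans ?_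
      simp_rw [Real.norm_of_nonneg (kern_nonneg n s _)]
      exact setIntegral_le_integral (integrable_kern_right hn hs0 hy0)
        (ae_of_all _ fun h => kern_nonneg n s _)
    · rw [Set.indicator_of_notMem (by exact hy), norm_zero]
      exact integral_nonneg fun h => hK0 _
  calc 2 ^ (-P) * (ω.toReal / 4) * ρ ^ (-s) - C / 2 * r ^ (-s)
      ≤ (∫ z in D, K z) - (∫ z, K z) / 2 := by linarith
    _ = _ := hint.symm
    _ ≤ _ := integral_mono (hDi'.sub hKi') hflux hpt

/-! ### Choice of the radius, and the hemisphere -/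

lemma integrable_min_div_rpow {n : ℕ} (hn : 1 ≤ n) {s R : ℝ} (hs0 : 0 < s) (hs1 : s < 1)
    (hR : 0 < R) :
    Integrable fun z : Rn n => min ‖z‖ R / ‖z‖ ^ ((n : ℝ) + s) := by
  have : Nonempty (Fin n) := ⟨⟨0, hn⟩⟩
  have key : ∀ t : ℝ, 0 < t → t ^ (n - 1) * (min t R / t ^ ((n : ℝ) + s)) =
      min t R * t ^ (-1 - s) := by
    intro t ht
    have e : t ^ (n - 1) / t ^ ((n : ℝ) + s) = t ^ (-1 - s) := by
      rw [← Real.rpow_natCast, ← Real.rpow_sub ht, Nat.cast_sub hn]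
      congr 1; push_cast; ring
    rw [← e]; ring
  rw [integrable_fun_norm_addHaar volume (f := fun t => min t R / t ^ ((n : ℝ) + s)),
    finrank_euclideanSpace_fin]
  simp only [smul_eq_mul]
  have key' : Set.EqOn (fun t : ℝ => t ^ (n - 1) * (min t R / t ^ ((n : ℝ) + s)))
      (fun t => min t R * t ^ (-1 - s)) (Set.Ioi 0) := fun t ht => key t ht
  rw [integrableOn_congr_fun key' measurableSet_Ioi,
    ← Set.Ioc_union_Ioi_eq_Ioi hR.le]
  refine IntegrableOn.union ?_ ?_
  · have h := (intervalIntegral.intervalIntegrable_rpow' (a := 0) (b := R) (r := -s)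
      (by linarith)).1
    refine h.congr_fun (fun t ht => ?_) measurableSet_Ioc
    simp only
    rw [min_eq_left ht.2]
    nth_rw 2 [← Real.rpow_one t]
    rw [← Real.rpow_add ht.1]
    congr 1; ring
  · have h : IntegrableOn (fun t : ℝ => R * t ^ (-1 - s)) (Set.Ioi R) :=
      (integrableOn_Ioi_rpow_of_lt (a := -1 - s) (by linarith) hR).const_mul R
    refine h.congr_fun (fun t ht => ?_) measurableSet_Ioi
    simp only
    rw [min_eq_right (le_of_lt ht)]

lemma lintegral_mul_comp_sub {n : ℕ} {g m : Rn n → ENNReal} (hg : AEMeasurable g)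
    (hm : Measurable m) :
    ∫⁻ z : Rn n × Rn n, g z.1 * m (z.1 - z.2) = (∫⁻ x, g x) * ∫⁻ y, m y := by
  have h : AEMeasurable (fun z : Rn n × Rn n => g z.1 * m (z.1 - z.2)) (volume.prod volume) :=
    AEMeasurable.mul hg.comp_fst (hm.comp (measurable_fst.sub measurable_snd)).aemeasurable
  rw [Measure.volume_eq_prod, lintegral_prod _ h]
  have : ∀ x : Rn n, ∫⁻ y, g x * m (x - y) = g x * ∫⁻ y, m y := fun x => by
    rw [lintegral_const_mul _ (by fun_prop), lintegral_sub_left_eq_self m x]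
  simp_rw [this]
  rw [lintegral_mul_const'' _ hg]

lemma lintegral_ofReal_lt_top {α : Type*} [MeasurableSpace α] {μ : Measure α} {f : α → ℝ}
    (hf : Integrable f μ) : ∫⁻ x, ENNReal.ofReal (f x) ∂μ < ⊤ :=
  (lintegral_mono fun x => Real.ofReal_le_enorm (f x)).trans_lt hf.hasFiniteIntegral

/-- The pairs of points that the sphere of radius `r` around `x₁` separates, the inner one first. -/
def crossing {n : ℕ} (x₁ : Rn n) (r : ℝ) : Set (Rn n × Rn n) :=
  {z | z.1 ∈ Metric.ball x₁ r ∧ z.2 ∉ Metric.ball x₁ r}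

/-- For an integrable weight, almost every sphere is crossed by finite weighted interaction. -/
lemma exists_radius {n : ℕ} (hn : 1 ≤ n) {s : ℝ} (hs0 : 0 < s) (hs1 : s < 1)
    {g : Rn n → ENNReal} (hg : AEMeasurable g) (hgi : ∫⁻ x, g x < ⊤) (x₁ : Rn n) {R : ℝ}
    (hR : 0 < R) : ∃ r, R / 4 < r ∧ r < R / 2 ∧
      ∫⁻ z in crossing x₁ r, g z.1 * ENNReal.ofReal (1 / ‖z.1 - z.2‖ ^ ((n : ℝ) + s)) < ⊤ := by
  set k : Rn n → ENNReal := fun z => ENNReal.ofReal (1 / ‖z‖ ^ ((n : ℝ) + s)) with hk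
  have hkm : Measurable k := by fun_prop
  set h : ℝ → Rn n × Rn n → ENNReal :=
    fun r => (crossing x₁ r).indicator fun z => g z.1 * k (z.1 - z.2) with hh
  set μ : Measure ℝ := volume.restrict (Set.Ioo (R / 4) (R / 2)) with hμ
  have hcm : MeasurableSet {q : ℝ × (Rn n × Rn n) | q.2 ∈ crossing x₁ q.1} := by
    have : {q : ℝ × (Rn n × Rn n) | q.2 ∈ crossing x₁ q.1} =
        {q | dist q.2.1 x₁ < q.1} ∩ {q | q.1 ≤ dist q.2.2 x₁} := by
      ext q; simp [crossing]
    rw [this]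
    exact (measurableSet_lt (by fun_prop) (by fun_prop)).inter
      (measurableSet_le (by fun_prop) (by fun_prop))
  have hgk : AEMeasurable (fun z : Rn n × Rn n => g z.1 * k (z.1 - z.2)) :=
    AEMeasurable.mul (hg.comp_fst (ν := volume))
      (hkm.comp (measurable_fst.sub measurable_snd)).aemeasurable
  have hm : AEMeasurable (Function.uncurry h) (μ.prod volume) := by
    have e : Function.uncurry h = {q : ℝ × (Rn n × Rn n) | q.2 ∈ crossing x₁ q.1}.indicator
        fun q => g q.2.1 * k (q.2.1 - q.2.2) := by
      ext q
      by_cases hq : q.2 ∈ crossing x₁ q.1 <;>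
        simp [Function.uncurry, hh, hq]
    rw [e]
    exact AEMeasurable.indicator (hgk.comp_snd (μ := μ)) hcm
  have hfin : ∫⁻ r, (∫⁻ z, h r z) ∂μ < ⊤ := by
    rw [lintegral_lintegral_swap hm]
    have hpt : ∀ z : Rn n × Rn n, ∫⁻ r, h r z ∂μ ≤
        g z.1 * ENNReal.ofReal (min ‖z.1 - z.2‖ R / ‖z.1 - z.2‖ ^ ((n : ℝ) + s)) := by
      intro z
      set d := ‖z.1 - z.2‖ with hd
      have hd' : dist z.2 x₁ ≤ d + dist z.1 x₁ := by
        rw [hd, ← dist_eq_norm, dist_comm z.1 z.2]; exact dist_triangle _ _ _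
      set I : Set ℝ := Set.Ioc (dist z.1 x₁) (dist z.2 x₁) with hI
      have e : ∀ r, h r z = I.indicator (fun _ => g z.1 * k (z.1 - z.2)) r := fun r => by
        simp [hh, hI, crossing, Set.indicator_apply]
      simp_rw [e]
      rw [lintegral_indicator_const measurableSet_Ioc, mul_assoc]
      gcongr
      have hv : μ I ≤ ENNReal.ofReal (min d R) := by
        rw [ENNReal.ofReal_min]
        refine le_min ?_ ?_
        · refine (Measure.restrict_apply_le _ _).trans ?_
          rw [hI, Real.volume_Ioc]
          exact ENNReal.ofReal_le_ofReal (by linarith)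
        · refine (measure_mono (Set.subset_univ _)).trans ?_
          rw [hμ, Measure.restrict_apply_univ, Real.volume_Ioo]
          exact ENNReal.ofReal_le_ofReal (by linarith)
      refine (mul_le_mul_right hv _).trans ?_
      simp only [hk]
      rw [← ENNReal.ofReal_mul (by positivity), ← hd]
      exact ENNReal.ofReal_le_ofReal (le_of_eq (by ring))
    refine (lintegral_mono hpt).trans_lt ?_
    have := lintegral_mul_comp_sub hg
      (m := fun z => ENNReal.ofReal (min ‖z‖ R / ‖z‖ ^ ((n : ℝ) + s))) (by fun_prop)
    rw [this]
    exact ENNReal.mul_lt_top hgi (lintegral_ofReal_lt_top (integrable_min_div_rpow hn hs0 hs1 hR))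
  have hae : ∀ᵐ r ∂μ, ∫⁻ z, h r z < ⊤ :=
    ae_lt_top' (AEMeasurable.lintegral_prod_right' hm) hfin.ne
  have hmem : ∀ᵐ r ∂μ, r ∈ Set.Ioo (R / 4) (R / 2) := ae_restrict_mem measurableSet_Ioo
  have hne : (ae μ).NeBot := by
    rw [ae_neBot, hμ, Ne, Measure.restrict_eq_zero, Real.volume_Ioo]
    simp; linarith
  obtain ⟨r, h1, h2⟩ := (hae.and hmem).exists
  refine ⟨r, h2.1, h2.2, ?_⟩
  have hcr : MeasurableSet (crossing x₁ r) := measurable_prodMk_left hcm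
  rw [← lintegral_indicator hcr]
  exact h1

/-- The lower half of the sphere of radius `r` whose lowest point is `(x₁, 0)`, as a graph over
the ball of radius `r` around `x₁`. -/
def hemi {n : ℕ} (r : ℝ) (x₁ x : Rn n) : ℝ := r - √(r ^ 2 - ‖x - x₁‖ ^ 2)

lemma continuous_hemi {n : ℕ} (r : ℝ) (x₁ : Rn n) : Continuous (hemi r x₁) := by
  unfold hemi; fun_prop

lemma hemi_nonneg {n : ℕ} {r : ℝ} (hr : 0 ≤ r) (x₁ x : Rn n) : 0 ≤ hemi r x₁ x := by
  have : √(r ^ 2 - ‖x - x₁‖ ^ 2) ≤ r := (Real.sqrt_le_left hr).2 (by nlinarith [sq_nonneg ‖x - x₁‖])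
  unfold hemi; linarith

lemma hemi_le_norm {n : ℕ} {r : ℝ} {x₁ x : Rn n} (hx : ‖x - x₁‖ ≤ r) :
    hemi r x₁ x ≤ ‖x - x₁‖ := by
  have h0 := norm_nonneg (x - x₁)
  have : r - ‖x - x₁‖ ≤ √(r ^ 2 - ‖x - x₁‖ ^ 2) :=
    Real.le_sqrt_of_sq_le (by nlinarith)
  unfold hemi; linarith

/-- The hemisphere has finite `W^{s,1}` seminorm on its ball, although its slope blows up at the
boundary. -/
lemma lintegral_hemi_lt_top {n : ℕ} (hn : 1 ≤ n) {s : ℝ} (hs0 : 0 < s) (hs1 : s < 1) {r : ℝ}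
    (hr : 0 < r) (x₁ : Rn n) :
    ∫⁻ z in Metric.ball x₁ r ×ˢ Metric.ball x₁ r,
      ENNReal.ofReal (|hemi r x₁ z.1 - hemi r x₁ z.2| / ‖z.1 - z.2‖ ^ ((n : ℝ) + s)) < ⊤ := by
  have : Nonempty (Fin n) := ⟨⟨0, hn⟩⟩
  set φ : ℝ → ℝ := fun t => 2 * r / √(r ^ 2 - t ^ 2) with hφ
  have hφi : IntegrableOn (fun x : Rn n => φ ‖x‖) (Metric.ball 0 r) := by
    rw [integrableOn_fun_norm_addHaar, finrank_euclideanSpace_fin]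
    have h0 := (intervalIntegral.intervalIntegrable_rpow' (a := 0) (b := r) (r := -(1 / 2))
      (by norm_num)).comp_sub_left r
    simp only [sub_zero, sub_self] at h0
    have h1 : IntegrableOn (fun t : ℝ => (r - t) ^ (-(1 / 2) : ℝ)) (Set.Ioo 0 r) :=
      (intervalIntegrable_iff_integrableOn_Ioo_of_le hr.le).1 h0.symm
    refine (h1.const_mul (r ^ (n - 1) * (2 * r * r ^ (-(1 / 2) : ℝ)))).mono'
      (by fun_prop) ?_
    filter_upwards [ae_restrict_mem measurableSet_Ioo] with t ht
    have ht1 : 0 < r - t := by linarith [ht.2]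
    have ht0 : 0 < t := ht.1
    rw [Real.norm_of_nonneg (by simp only [hφ, smul_eq_mul]; positivity), smul_eq_mul]
    have hle : 1 / √(r ^ 2 - t ^ 2) ≤ r ^ (-(1 / 2) : ℝ) * (r - t) ^ (-(1 / 2) : ℝ) := by
      rw [← Real.mul_rpow hr.le ht1.le, Real.rpow_neg (by positivity), ← Real.sqrt_eq_rpow,
        ← one_div]
      have : 0 < √(r * (r - t)) := Real.sqrt_pos.2 (by positivity)
      gcongr
      nlinarith
    calc t ^ (n - 1) * φ t = t ^ (n - 1) * (2 * r * (1 / √(r ^ 2 - t ^ 2))) := by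
          simp only [hφ]; ring
      _ ≤ r ^ (n - 1) * (2 * r * (r ^ (-(1 / 2) : ℝ) * (r - t) ^ (-(1 / 2) : ℝ))) := by
          gcongr
          exact ht.2.le
      _ = _ := by ring
  set g : Rn n → ENNReal := fun x =>
    (Metric.ball (0 : Rn n) r).indicator (fun x => ENNReal.ofReal (φ ‖x‖)) (x - x₁) with hg
  have hφm : Measurable φ := by fun_prop
  have hgm0 : Measurable ((Metric.ball (0 : Rn n) r).indicator fun x => ENNReal.ofReal (φ ‖x‖)) :=
    Measurable.indicator (by fun_prop) measurableSet_ball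
  have hgm : Measurable g := hgm0.comp (measurable_id.sub_const x₁)
  have hgi : ∫⁻ x, g x < ⊤ := by
    rw [hg, lintegral_sub_right_eq_self
      ((Metric.ball (0 : Rn n) r).indicator fun x => ENNReal.ofReal (φ ‖x‖)) x₁,
      lintegral_indicator measurableSet_ball]
    exact lintegral_ofReal_lt_top hφi
  have hle : ∫⁻ z in Metric.ball x₁ r ×ˢ Metric.ball x₁ r,
      ENNReal.ofReal (|hemi r x₁ z.1 - hemi r x₁ z.2| / ‖z.1 - z.2‖ ^ ((n : ℝ) + s)) ≤
      ∫⁻ z : Rn n × Rn n, g z.1 *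
        ENNReal.ofReal (min ‖z.1 - z.2‖ (2 * r) / ‖z.1 - z.2‖ ^ ((n : ℝ) + s)) := by
    refine le_trans (setLIntegral_mono' (measurableSet_ball.prod measurableSet_ball) ?_)
      (setLIntegral_le_lintegral _ _)
    rintro ⟨x, y⟩ ⟨hx, hy⟩
    simp only [mem_ball_iff_norm] at hx hy ⊢
    have hgx : g x = ENNReal.ofReal (φ ‖x - x₁‖) := by
      rw [hg]; exact Set.indicator_of_mem (by simpa using hx) _
    rw [hgx, ← ENNReal.ofReal_mul (by simp only [hφ]; positivity), ← mul_div_assoc]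
    refine ENNReal.ofReal_le_ofReal ?_
    gcongr
    have hxy : ‖x - y‖ ≤ 2 * r := by
      have := norm_sub_le (x - x₁) (y - x₁)
      rw [sub_sub_sub_cancel_right] at this
      linarith
    rw [min_eq_left hxy]
    set α := ‖x - x₁‖ with hα
    set β := ‖y - x₁‖ with hβ
    have hα0 : 0 ≤ α := norm_nonneg _
    have hβ0 : 0 ≤ β := norm_nonneg _
    have hαβ : |α - β| ≤ ‖x - y‖ := by
      have := abs_norm_sub_norm_le (x - x₁) (y - x₁)
      rwa [sub_sub_sub_cancel_right] at this
    have hA : 0 < r ^ 2 - α ^ 2 := by nlinarith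
    have hB : 0 < r ^ 2 - β ^ 2 := by nlinarith
    have hA' := Real.sqrt_pos.2 hA
    have hB' := Real.sqrt_pos.2 hB
    simp only [hemi, hφ, ← hα, ← hβ]
    rw [div_mul_eq_mul_div, le_div_iff₀ hA']
    have e : (r - √(r ^ 2 - α ^ 2) - (r - √(r ^ 2 - β ^ 2))) *
        (√(r ^ 2 - α ^ 2) + √(r ^ 2 - β ^ 2)) = (α - β) * (α + β) := by
      nlinarith [Real.sq_sqrt hA.le, Real.sq_sqrt hB.le]
    calc |r - √(r ^ 2 - α ^ 2) - (r - √(r ^ 2 - β ^ 2))| * √(r ^ 2 - α ^ 2)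
        ≤ |r - √(r ^ 2 - α ^ 2) - (r - √(r ^ 2 - β ^ 2))| *
            |√(r ^ 2 - α ^ 2) + √(r ^ 2 - β ^ 2)| := by
          gcongr
          rw [abs_of_pos (by positivity)]
          linarith
      _ = |α - β| * |α + β| := by rw [← abs_mul, e, abs_mul]
      _ ≤ ‖x - y‖ * (2 * r) := by
          rw [abs_of_nonneg (by positivity : 0 ≤ α + β)]
          gcongr
          linarith
      _ = _ := by ring
  refine hle.trans_lt ?_
  rw [lintegral_mul_comp_sub hgm.aemeasurable
    (m := fun z => ENNReal.ofReal (min ‖z‖ (2 * r) / ‖z‖ ^ ((n : ℝ) + s))) (by fun_prop)]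
  exact ENNReal.mul_lt_top hgi
    (lintegral_ofReal_lt_top (integrable_min_div_rpow hn hs0 hs1 (by positivity)))

/-! ### The competitor -/

lemma integrable_mul_comp_sub {n : ℕ} {w m : Rn n → ℝ} (hw : Integrable w) (hm : Integrable m)
    (hmm : Measurable m) : Integrable fun z : Rn n × Rn n => w z.1 * m (z.1 - z.2) := by
  refine ⟨(AEStronglyMeasurable.comp_fst hw.1).mul
    (hmm.comp (measurable_fst.sub measurable_snd)).aestronglyMeasurable, ?_⟩
  rw [HasFiniteIntegral]
  simp_rw [enorm_mul]
  rw [lintegral_mul_comp_sub hw.1.enorm (m := fun y => ‖m y‖ₑ) hmm.enorm]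
  exact ENNReal.mul_lt_top hw.2 hm.2

/-- The excess of `u` over the barrier `K + hemi`, which is `+∞` outside the ball. -/
def excess {n : ℕ} (K r : ℝ) (x₁ : Rn n) (u : Rn n → ℝ) : Rn n → ℝ :=
  (Metric.ball x₁ r).indicator fun x => max (u x - (K + hemi r x₁ x)) 0

section excess
variable {n : ℕ} {s K r : ℝ} {x₁ : Rn n} {u : Rn n → ℝ} {Ω : Set (Rn n)}

lemma excess_of_notMem {x : Rn n} (hx : x ∉ Metric.ball x₁ r) : excess K r x₁ u x = 0 :=
  Set.indicator_of_notMem hx _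

lemma excess_of_mem {x : Rn n} (hx : x ∈ Metric.ball x₁ r) :
    excess K r x₁ u x = max (u x - (K + hemi r x₁ x)) 0 :=
  Set.indicator_of_mem hx _

lemma excess_nonneg (x : Rn n) : 0 ≤ excess K r x₁ u x :=
  Set.indicator_nonneg (fun _ _ => le_max_right _ _) x

lemma excess_le_abs (hK : 0 ≤ K) (hr : 0 ≤ r) (x : Rn n) : excess K r x₁ u x ≤ |u x| := by
  by_cases hx : x ∈ Metric.ball x₁ r
  · rw [excess_of_mem hx]
    have := hemi_nonneg hr x₁ x
    exact max_le (by linarith [le_abs_self (u x)]) (abs_nonneg _)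
  · rw [excess_of_notMem hx]
    exact abs_nonneg _

lemma sub_excess_le_barrier {x : Rn n} (hx : x ∈ Metric.ball x₁ r) :
    u x - excess K r x₁ u x ≤ K + hemi r x₁ x := by
  rw [excess_of_mem hx]
  linarith [le_max_left (u x - (K + hemi r x₁ x)) 0]

lemma aemeasurable_excess (hu : AEMeasurable u) : AEMeasurable (excess K r x₁ u) := by
  have := (continuous_hemi r x₁).measurable
  exact AEMeasurable.indicator (by fun_prop) measurableSet_ball

lemma integrable_excess (hK : 0 ≤ K) (hr : 0 ≤ r) (hu : AEMeasurable u) (hΩ : MeasurableSet Ω)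
    (hB : Metric.ball x₁ r ⊆ Ω) (hui : IntegrableOn u Ω) : Integrable (excess K r x₁ u) := by
  refine (IntegrableOn.integrable_indicator (f := fun x => |u x|) hui.abs hΩ).mono' (aemeasurable_excess hu).aestronglyMeasurable
    (ae_of_all _ fun x => ?_)
  rw [Real.norm_of_nonneg (excess_nonneg x)]
  by_cases hx : x ∈ Metric.ball x₁ r
  · rw [Set.indicator_of_mem (hB hx)]
    exact excess_le_abs hK hr x
  · rw [excess_of_notMem hx]
    exact Set.indicator_nonneg (fun _ _ => abs_nonneg _) x

lemma aemeasurable_gagliardo (hu : AEMeasurable u) : AEMeasurable fun z : Rn n × Rn n =>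
    ENNReal.ofReal (|u z.1 - u z.2| / ‖z.1 - z.2‖ ^ ((n : ℝ) + s)) := by
  have h1 : AEMeasurable (fun z : Rn n × Rn n => u z.1) := hu.comp_fst (ν := volume)
  have h2 : AEMeasurable (fun z : Rn n × Rn n => u z.2) := hu.comp_snd (μ := volume)
  have h3 : AEMeasurable (fun z : Rn n × Rn n => |u z.1 - u z.2|) := by
    simp_rw [← Real.norm_eq_abs]
    exact (h1.sub h2).norm
  exact (h3.div (by fun_prop)).ennreal_ofReal

lemma gagliardo_eq_lintegral_prod (hu : AEMeasurable u) :
    gagliardo s Ω u =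
      ∫⁻ z in Ω ×ˢ Ω, ENNReal.ofReal (|u z.1 - u z.2| / ‖z.1 - z.2‖ ^ ((n : ℝ) + s)) := by
  rw [Measure.volume_eq_prod, ← Measure.prod_restrict, lintegral_prod]
  · rfl
  · rw [Measure.prod_restrict]; exact (aemeasurable_gagliardo hu).restrict

/-- The excess has finite `W^{s,1}(ℝⁿ)` seminorm if the sphere over which it is cut off is crossed
by finite interaction. -/
lemma lintegral_excess_lt_top (hn : 1 ≤ n) (hs0 : 0 < s) (hs1 : s < 1) (hK : 0 ≤ K) (hr : 0 < r)
    (hu : AEMeasurable u) (hΩ : MeasurableSet Ω) (hB : Metric.ball x₁ r ⊆ Ω)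
    (hug : gagliardo s Ω u < ⊤)
    (hcr : ∫⁻ z in crossing x₁ r, Ω.indicator (fun x => ENNReal.ofReal |u x|) z.1 *
      ENNReal.ofReal (1 / ‖z.1 - z.2‖ ^ ((n : ℝ) + s)) < ⊤) :
    ∫⁻ z : Rn n × Rn n, ENNReal.ofReal
      (|excess K r x₁ u z.1 - excess K r x₁ u z.2| / ‖z.1 - z.2‖ ^ ((n : ℝ) + s)) < ⊤ := by
  set w := excess K r x₁ u with hw
  set B := Metric.ball x₁ r with hBdef
  set f₁ : Rn n × Rn n → ENNReal := (Ω ×ˢ Ω).indicator fun z =>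
    ENNReal.ofReal (|u z.1 - u z.2| / ‖z.1 - z.2‖ ^ ((n : ℝ) + s)) with hf₁
  set f₂ : Rn n × Rn n → ENNReal := (B ×ˢ B).indicator fun z =>
    ENNReal.ofReal (|hemi r x₁ z.1 - hemi r x₁ z.2| / ‖z.1 - z.2‖ ^ ((n : ℝ) + s)) with hf₂
  set f₃ : Rn n × Rn n → ENNReal := (crossing x₁ r).indicator fun z =>
    Ω.indicator (fun x => ENNReal.ofReal |u x|) z.1 *
      ENNReal.ofReal (1 / ‖z.1 - z.2‖ ^ ((n : ℝ) + s)) with hf₃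
  have hcrm : MeasurableSet (crossing x₁ r) :=
    (measurable_fst measurableSet_ball).inter (measurable_snd measurableSet_ball.compl)
  have h₁ : ∫⁻ z, f₁ z < ⊤ := by
    rw [hf₁, lintegral_indicator (hΩ.prod hΩ), ← gagliardo_eq_lintegral_prod hu]
    exact hug
  have h₂ : ∫⁻ z, f₂ z < ⊤ := by
    rw [hf₂, lintegral_indicator (measurableSet_ball.prod measurableSet_ball)]
    exact lintegral_hemi_lt_top hn hs0 hs1 hr x₁
  have h₃ : ∫⁻ z, f₃ z < ⊤ := by
    rw [hf₃, lintegral_indicator hcrm]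
    exact hcr
  have h₄ : ∫⁻ z : Rn n × Rn n, f₃ z.swap < ⊤ := by
    have := (Measure.measurePreserving_swap (μ := (volume : Measure (Rn n)))
      (ν := (volume : Measure (Rn n)))).lintegral_comp_emb
      MeasurableEquiv.prodComm.measurableEmbedding f₃
    rw [Measure.volume_eq_prod] at h₃ ⊢
    rwa [this]
  have hcross : ∀ x y, x ∈ B → y ∉ B →
      ENNReal.ofReal (|w x - w y| / ‖x - y‖ ^ ((n : ℝ) + s)) ≤ f₃ (x, y) := by
    intro x y hx hy
    rw [hf₃, Set.indicator_of_mem (show (x, y) ∈ crossing x₁ r from ⟨hx, hy⟩)]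
    simp only
    rw [Set.indicator_of_mem (hB hx), ← ENNReal.ofReal_mul (abs_nonneg _), mul_one_div, hw,
      excess_of_notMem hy, sub_zero, abs_of_nonneg (excess_nonneg x)]
    refine ENNReal.ofReal_le_ofReal ?_
    gcongr
    exact excess_le_abs hK hr.le x
  have hpt : ∀ z : Rn n × Rn n,
      ENNReal.ofReal (|w z.1 - w z.2| / ‖z.1 - z.2‖ ^ ((n : ℝ) + s)) ≤
        (f₁ z + f₂ z) + (f₃ z + f₃ z.swap) := by
    rintro ⟨x, y⟩
    by_cases hx : x ∈ B <;> by_cases hy : y ∈ B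
    · refine le_trans ?_ le_self_add
      rw [hf₁, hf₂, Set.indicator_of_mem (Set.mk_mem_prod (hB hx) (hB hy)),
        Set.indicator_of_mem (Set.mk_mem_prod hx hy),
        ← ENNReal.ofReal_add (by positivity) (by positivity), ← add_div]
      refine ENNReal.ofReal_le_ofReal ?_
      simp only
      gcongr
      rw [hw, excess_of_mem hx, excess_of_mem hy]
      refine (abs_max_sub_max_le_abs _ _ _).trans ?_
      have : u x - (K + hemi r x₁ x) - (u y - (K + hemi r x₁ y)) =
        (u x - u y) - (hemi r x₁ x - hemi r x₁ y) := by ring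
      rw [this]
      exact abs_sub _ _
    · exact (hcross x y hx hy).trans (le_self_add.trans le_add_self)
    · have := hcross y x hy hx
      rw [abs_sub_comm, norm_sub_rev] at this
      exact this.trans (le_add_self.trans le_add_self)
    · simp only
      rw [hw, excess_of_notMem hx, excess_of_notMem hy]
      simp
  refine (lintegral_mono hpt).trans_lt ?_
  have hm₁ : AEMeasurable f₁ := (aemeasurable_gagliardo hu).indicator (hΩ.prod hΩ)
  have hm₂ : Measurable f₂ := by
    have := (continuous_hemi r x₁).measurable
    exact Measurable.indicator (by fun_prop) (measurableSet_ball.prod measurableSet_ball)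
  have hm₃ : AEMeasurable f₃ := by
    have h0 : AEMeasurable (Ω.indicator fun x => ENNReal.ofReal |u x|) := by
      simp_rw [← Real.norm_eq_abs]
      exact hu.norm.ennreal_ofReal.indicator hΩ
    have h1 : AEMeasurable (fun z : Rn n × Rn n =>
      Ω.indicator (fun x => ENNReal.ofReal |u x|) z.1) := h0.comp_fst (ν := volume)
    exact (h1.mul (by fun_prop)).indicator hcrm
  have hm₁₂ : AEMeasurable fun z => f₁ z + f₂ z := hm₁.add hm₂.aemeasurable
  rw [lintegral_add_left' hm₁₂, lintegral_add_left' hm₁,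
    lintegral_add_left' hm₃]
  exact ENNReal.add_lt_top.2 ⟨ENNReal.add_lt_top.2 ⟨h₁, h₂⟩, ENNReal.add_lt_top.2 ⟨h₃, h₄⟩⟩

/-- Cutting `u` off at a barrier above the obstacle gives an admissible competitor. -/
lemma sub_excess_mem_WObst {φ ψ : Rn n → ℝ} {A : Set (Rn n)} (hK : 0 ≤ K) (hr : 0 ≤ r)
    (hu : AEMeasurable u) (hΩ : MeasurableSet Ω) (hB : Metric.ball x₁ r ⊆ Ω)
    (huW : u ∈ WObst s φ ψ Ω A) (hψ : ∀ᵐ x ∂(volume.restrict A), ψ x ≤ K)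
    (hw : ∫⁻ z : Rn n × Rn n, ENNReal.ofReal
      (|excess K r x₁ u z.1 - excess K r x₁ u z.2| / ‖z.1 - z.2‖ ^ ((n : ℝ) + s)) < ⊤) :
    (fun x => u x - excess K r x₁ u x) ∈ WObst s φ ψ Ω A := by
  obtain ⟨⟨hui, hug⟩, hφ, hobst⟩ := huW
  have hwm : AEMeasurable (excess K r x₁ u) := aemeasurable_excess hu
  have hvm : AEMeasurable (fun x => u x - excess K r x₁ u x) := hu.sub hwm
  refine ⟨⟨hui.sub (integrable_excess hK hr hu hΩ hB hui).integrableOn, ?_⟩, ?_, ?_⟩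
  · rw [gagliardo_eq_lintegral_prod hu] at hug
    rw [gagliardo_eq_lintegral_prod hvm]
    refine lt_of_le_of_lt (lintegral_mono (g := fun z : Rn n × Rn n =>
      ENNReal.ofReal (|u z.1 - u z.2| / ‖z.1 - z.2‖ ^ ((n : ℝ) + s)) + ENNReal.ofReal
      (|excess K r x₁ u z.1 - excess K r x₁ u z.2| / ‖z.1 - z.2‖ ^ ((n : ℝ) + s)))
      fun z => ?_) ?_
    · simp only
      rw [← ENNReal.ofReal_add (by positivity) (by positivity), ← add_div]
      refine ENNReal.ofReal_le_ofReal ?_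
      gcongr
      rw [sub_sub_sub_comm]
      exact abs_sub _ _
    · rw [lintegral_add_left' (aemeasurable_gagliardo hu).restrict]
      exact ENNReal.add_lt_top.2 ⟨hug, (setLIntegral_le_lintegral _ _).trans_lt hw⟩
  · intro x hx
    simp only
    rw [excess_of_notMem fun h => hx (hB h), sub_zero]
    exact hφ x hx
  · filter_upwards [hobst, hψ] with x h1 h2
    by_cases hx : x ∈ Metric.ball x₁ r
    · rw [excess_of_mem hx]
      have := hemi_nonneg hr x₁ x
      rcases max_cases (u x - (K + hemi r x₁ x)) 0 with ⟨h, _⟩ | ⟨h, _⟩ <;> rw [h] <;> linarith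
    · rw [excess_of_notMem hx, sub_zero]
      exact h1

end excess

/-! ### The linearized variational inequality -/

/-- The variational inequality of the obstacle problem, linearized at the competitor `v = u - w`
by convexity. -/
lemma linearized_inequality {n : ℕ} (hn : 1 ≤ n) {s : ℝ} (hs0 : 0 < s)
    {φ ψ u v : Rn n → ℝ} {Ω A : Set (Rn n)} (hu : AEMeasurable u) (hv : AEMeasurable v)
    (hsol : SolvesObstacle s φ ψ Ω A u) (hvW : v ∈ WObst s φ ψ Ω A)
    (hw : ∫⁻ z : Rn n × Rn n, ENNReal.ofReal
      (|(u z.1 - v z.1) - (u z.2 - v z.2)| / ‖z.1 - z.2‖ ^ ((n : ℝ) + s)) < ⊤) :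
    Integrable (fun z : Rn n × Rn n => Gs n s ((v z.1 - v z.2) / ‖z.1 - z.2‖) /
      ‖z.1 - z.2‖ ^ ((n : ℝ) + s) * ((u z.1 - v z.1) - (u z.2 - v z.2))) ∧
    ∫ z : Rn n × Rn n, Gs n s ((v z.1 - v z.2) / ‖z.1 - z.2‖) /
      ‖z.1 - z.2‖ ^ ((n : ℝ) + s) * ((u z.1 - v z.1) - (u z.2 - v z.2)) ≤ 0 := by
  set C : ℝ := ∫ τ, gs n s τ with hC
  have hu1 : AEMeasurable (fun z : Rn n × Rn n => u z.1) := hu.comp_fst (ν := volume)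
  have hu2 : AEMeasurable (fun z : Rn n × Rn n => u z.2) := hu.comp_snd (μ := volume)
  have hv1 : AEMeasurable (fun z : Rn n × Rn n => v z.1) := hv.comp_fst (ν := volume)
  have hv2 : AEMeasurable (fun z : Rn n × Rn n => v z.2) := hv.comp_snd (μ := volume)
  have hd : Measurable fun z : Rn n × Rn n => ‖z.1 - z.2‖ := by fun_prop
  set δ : Rn n × Rn n → ℝ := fun z => (u z.1 - v z.1) - (u z.2 - v z.2) with hδ
  have hδm : AEMeasurable δ := (hu1.sub hv1).sub (hu2.sub hv2)
  set E : Rn n × Rn n → ℝ := fun z => |δ z| / ‖z.1 - z.2‖ ^ ((n : ℝ) + s) with hE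
  have hEm : AEMeasurable E := by
    simp only [hE, ← Real.norm_eq_abs]
    exact hδm.norm.div (by fun_prop)
  have hE0 : ∀ z, 0 ≤ E z := fun z => by simp only [hE]; positivity
  have hEi : Integrable E := by
    refine ⟨hEm.aestronglyMeasurable, ?_⟩
    rw [hasFiniteIntegral_iff_ofReal (ae_of_all _ hE0)]
    exact hw
  set H : Rn n × Rn n → ℝ := fun z => Gs n s ((v z.1 - v z.2) / ‖z.1 - z.2‖) /
      ‖z.1 - z.2‖ ^ ((n : ℝ) + s) * δ z with hH
  have hHm : AEMeasurable H :=
    (((continuous_Gs n s).measurable.comp_aemeasurable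
      ((hv1.sub hv2).div hd.aemeasurable)).div (by fun_prop)).mul hδm
  have hHi : Integrable H := by
    refine (hEi.const_mul C).mono' hHm.aestronglyMeasurable (ae_of_all _ fun z => ?_)
    simp only [hH, hE]
    rw [Real.norm_eq_abs, abs_mul, abs_div, abs_of_nonneg
      (by positivity : 0 ≤ ‖z.1 - z.2‖ ^ ((n : ℝ) + s)), div_mul_eq_mul_div, mul_div_assoc]
    gcongr
    exact abs_Gs_le hn hs0 _
  refine ⟨hHi, ?_⟩
  set F : Rn n × Rn n → ℝ := fun z =>
    (GGs n s ((u z.1 - u z.2) / ‖z.1 - z.2‖) - GGs n s ((v z.1 - v z.2) / ‖z.1 - z.2‖))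
          / ‖z.1 - z.2‖ ^ ((n : ℝ) - 1 + s) with hF
  have hFm : AEMeasurable F :=
    (((continuous_GGs n s).measurable.comp_aemeasurable
      ((hu1.sub hu2).div hd.aemeasurable)).sub ((continuous_GGs n s).measurable.comp_aemeasurable
      ((hv1.sub hv2).div hd.aemeasurable))).div (by fun_prop)
  have hdiff : ∀ z : Rn n × Rn n, (u z.1 - u z.2) / ‖z.1 - z.2‖ - (v z.1 - v z.2) / ‖z.1 - z.2‖ =
      δ z / ‖z.1 - z.2‖ := fun z => by simp only [hδ]; ring
  have hpow : ∀ d : ℝ, 0 < d → d ^ ((n : ℝ) + s) = d * d ^ ((n : ℝ) - 1 + s) := by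
    intro d hd
    nth_rw 2 [← Real.rpow_one d]
    rw [← Real.rpow_add hd]
    congr 1; ring
  have hdiag : ∀ z : Rn n × Rn n, ¬ 0 < ‖z.1 - z.2‖ → z.1 = z.2 := fun z hz => by
    rw [norm_pos_iff, not_not] at hz
    exact sub_eq_zero.1 hz
  have hFi : Integrable F := by
    refine (hEi.const_mul C).mono' hFm.aestronglyMeasurable (ae_of_all _ fun z => ?_)
    by_cases hz : 0 < ‖z.1 - z.2‖
    · simp only [hF, hE]
      rw [Real.norm_eq_abs, abs_div, abs_of_nonneg
        (by positivity : 0 ≤ ‖z.1 - z.2‖ ^ ((n : ℝ) - 1 + s)), hpow _ hz, ← div_div,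
        ← mul_div_assoc]
      gcongr
      refine (abs_GGs_sub_le hn hs0 _ _).trans_eq ?_
      rw [hdiff, abs_div, abs_of_pos hz]
    · simp [hF, hE, hdiag z hz, hδ]
  have hHF : ∀ z, H z ≤ F z := by
    intro z
    by_cases hz : 0 < ‖z.1 - z.2‖
    · simp only [hF, hH]
      rw [hpow _ hz, ← div_div, div_mul_eq_mul_div, ← mul_div_right_comm]
      gcongr
      refine le_trans (le_of_eq ?_) (Gs_mul_sub_le_GGs_sub n s _ _)
      rw [hdiff, mul_div_assoc]
    · simp [hF, hH, hdiag z hz, hδ]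
  have hQ : ∫ z in Q Ω, F z = ∫ z, F z := by
    refine setIntegral_eq_integral_of_forall_compl_eq_zero fun z hz => ?_
    have hz' : z.1 ∉ Ω ∧ z.2 ∉ Ω := by simpa [Q] using hz
    have h1 : u z.1 = v z.1 := (hsol.1.2.1 _ hz'.1).trans (hvW.2.1 _ hz'.1).symm
    have h2 : u z.2 = v z.2 := (hsol.1.2.1 _ hz'.2).trans (hvW.2.1 _ hz'.2).symm
    simp [hF, h1, h2]
  calc ∫ z, H z ≤ ∫ z, F z := integral_mono hHi hFi hHF
    _ = ∫ z in Q Ω, F z := hQ.symm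
    _ ≤ 0 := hsol.2 v hvW

/-- If the flux of `v` through every point where `w > 0` is at least `κ > 0`, uniformly in the
truncation, the linearized inequality forces `w` to vanish. -/
lemma ae_eq_zero_of_flux {n : ℕ} (hn : 1 ≤ n) {s : ℝ} (hs0 : 0 < s) (hs1 : s < 1)
    {v w : Rn n → ℝ} (hv : AEMeasurable v) (hw : Integrable w) (hw0 : ∀ x, 0 ≤ w x)
    (hHi : Integrable (fun z : Rn n × Rn n => Gs n s ((v z.1 - v z.2) / ‖z.1 - z.2‖) /
      ‖z.1 - z.2‖ ^ ((n : ℝ) + s) * (w z.1 - w z.2)))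
    (hH : ∫ z : Rn n × Rn n, Gs n s ((v z.1 - v z.2) / ‖z.1 - z.2‖) /
      ‖z.1 - z.2‖ ^ ((n : ℝ) + s) * (w z.1 - w z.2) ≤ 0)
    {κ ε : ℝ} (hκ : 0 < κ) (hε : 0 < ε)
    (hflux : ∀ τ, 0 < τ → τ < ε → ∀ x, w x ≠ 0 → κ ≤ ∫ y, {y : Rn n | τ < ‖y‖}.indicator
      (fun y => Gs n s ((v x - v (x + y)) / ‖y‖) / ‖y‖ ^ ((n : ℝ) + s)) y) :
    w =ᵐ[volume] 0 := by
  set H : Rn n × Rn n → ℝ := fun z => Gs n s ((v z.1 - v z.2) / ‖z.1 - z.2‖) /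
      ‖z.1 - z.2‖ ^ ((n : ℝ) + s) * (w z.1 - w z.2) with hHdef
  have hv1 : AEMeasurable (fun z : Rn n × Rn n => v z.1) := hv.comp_fst (ν := volume)
  have hv2 : AEMeasurable (fun z : Rn n × Rn n => v z.2) := hv.comp_snd (μ := volume)
  set far : ℝ → Set (Rn n × Rn n) := fun τ => {z | τ < ‖z.1 - z.2‖} with hfar
  have hfarm : ∀ τ, MeasurableSet (far τ) := fun τ =>
    measurableSet_lt (by fun_prop) (by fun_prop)
  have htrunc : ∀ τ, 0 < τ → τ < ε → 2 * (κ * ∫ x, w x) ≤ ∫ z, (far τ).indicator H z := by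
    intro τ hτ hτε
    set Ψ : Rn n × Rn n → ℝ := (far τ).indicator fun z =>
      Gs n s ((v z.1 - v z.2) / ‖z.1 - z.2‖) / ‖z.1 - z.2‖ ^ ((n : ℝ) + s) with hΨ
    have hΨm : AEMeasurable Ψ :=
      (((continuous_Gs n s).measurable.comp_aemeasurable ((hv1.sub hv2).div (by fun_prop))).div
        (by fun_prop)).indicator (hfarm τ)
    have hΨswap : ∀ z : Rn n × Rn n, Ψ z.swap = -Ψ z := by
      intro z
      have h1 : z.swap ∈ far τ ↔ z ∈ far τ := by
        simp only [hfar, Set.mem_ofPred_eq, Prod.fst_swap, Prod.snd_swap, norm_sub_rev]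
      by_cases hz : z ∈ far τ
      · rw [hΨ, Set.indicator_of_mem hz, Set.indicator_of_mem (h1.2 hz), Prod.fst_swap,
          Prod.snd_swap, norm_sub_rev z.2 z.1, ← neg_sub (v z.1) (v z.2), neg_div, Gs_neg, neg_div]
      · rw [hΨ, Set.indicator_of_notMem hz, Set.indicator_of_notMem (fun h => hz (h1.1 h)), neg_zero]
    set C : ℝ := ∫ t, gs n s t with hC
    have hC0 : 0 ≤ C := integral_nonneg (gs_nonneg n s)
    have hi1 : Integrable fun z : Rn n × Rn n => w z.1 * Ψ z := by
      have hm := (integrable_min_div_rpow hn hs0 hs1 hτ).const_mul (C / τ)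
      refine (integrable_mul_comp_sub hw hm (by fun_prop)).mono'
        ((AEMeasurable.comp_fst (ν := volume) hw.1.aemeasurable).mul hΨm).aestronglyMeasurable
        (ae_of_all _ fun z => ?_)
      rw [norm_mul, Real.norm_of_nonneg (hw0 _)]
      gcongr
      · exact hw0 _
      by_cases hz : z ∈ far τ
      · have hz' : τ < ‖z.1 - z.2‖ := hz
        rw [hΨ, Set.indicator_of_mem hz, min_eq_right hz'.le, ← mul_div_assoc,
          div_mul_cancel₀ _ hτ.ne', Real.norm_eq_abs, abs_div, abs_of_nonneg
          (by positivity : 0 ≤ ‖z.1 - z.2‖ ^ ((n : ℝ) + s))]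
        gcongr
        exact abs_Gs_le hn hs0 _
      · rw [hΨ, Set.indicator_of_notMem hz, norm_zero]
        positivity
    have hswap : MeasurePreserving (Prod.swap : Rn n × Rn n → Rn n × Rn n) volume volume :=
      Measure.measurePreserving_swap
    have hemb : MeasurableEmbedding (Prod.swap : Rn n × Rn n → Rn n × Rn n) :=
      MeasurableEquiv.prodComm.measurableEmbedding
    have hi2 : Integrable fun z : Rn n × Rn n => w z.2 * Ψ z := by
      have h := ((hswap.integrable_comp_emb hemb).2 hi1).neg
      refine h.congr (ae_of_all _ fun z => ?_)
      simp [hΨswap]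
    have he2 : ∫ z : Rn n × Rn n, w z.2 * Ψ z = -∫ z : Rn n × Rn n, w z.1 * Ψ z := by
      rw [← hswap.integral_comp hemb, ← integral_neg]
      refine integral_congr_ae (ae_of_all _ fun z => ?_)
      simp [hΨswap]
    have hsplit : ∀ z, (far τ).indicator H z = w z.1 * Ψ z - w z.2 * Ψ z := by
      intro z
      by_cases hz : z ∈ far τ
      · rw [hΨ, Set.indicator_of_mem hz, Set.indicator_of_mem hz]
        simp only [hHdef]; ring
      · rw [hΨ, Set.indicator_of_notMem hz, Set.indicator_of_notMem hz]
        ring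
    simp_rw [hsplit]
    rw [integral_sub hi1 hi2, he2]
    have hmain : κ * ∫ x, w x ≤ ∫ z : Rn n × Rn n, w z.1 * Ψ z := by
      rw [Measure.volume_eq_prod] at hi1 ⊢
      rw [integral_prod _ hi1, ← integral_const_mul]
      refine integral_mono (hw.const_mul κ) hi1.integral_prod_left fun x => ?_
      simp only
      rw [integral_const_mul]
      by_cases hx : w x = 0
      · simp [hx]
      · have e : ∫ y, Ψ (x, y) = ∫ y, {y : Rn n | τ < ‖y‖}.indicator
            (fun y => Gs n s ((v x - v (x + y)) / ‖y‖) / ‖y‖ ^ ((n : ℝ) + s)) y := by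
          rw [← integral_add_left_eq_self _ x]
          refine integral_congr_ae (ae_of_all _ fun y => ?_)
          simp [hΨ, hfar, Set.indicator_apply]
        rw [e, mul_comm]
        exact mul_le_mul_of_nonneg_left (hflux τ hτ hτε x hx) (hw0 x)
    linarith
  set t : ℕ → ℝ := fun j => ε / (j + 2) with ht
  have ht0 : ∀ j, 0 < t j := fun j => by simp only [ht]; positivity
  have htε : ∀ j, t j < ε := fun j => by
    simp only [ht]
    rw [div_lt_iff₀ (by positivity)]
    have : (0 : ℝ) ≤ j := j.cast_nonneg
    nlinarith
  have htlim : Filter.Tendsto t Filter.atTop (nhds 0) := by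
    have := (tendsto_const_div_atTop_nhds_zero_nat ε).comp (Filter.tendsto_add_atTop_nat 2)
    refine this.congr fun j => ?_
    simp [ht]
  have hlim : Filter.Tendsto (fun j => ∫ z, (far (t j)).indicator H z) Filter.atTop
      (nhds (∫ z, H z)) := by
    refine tendsto_integral_of_dominated_convergence (fun z => ‖H z‖)
      (fun j => (hHi.indicator (hfarm _)).aestronglyMeasurable) hHi.norm
      (fun j => ae_of_all _ fun z => norm_indicator_le_norm_self _ _) (ae_of_all _ fun z => ?_)
    by_cases hz : 0 < ‖z.1 - z.2‖
    · refine tendsto_const_nhds.congr' ?_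
      filter_upwards [htlim.eventually_lt_const hz] with j hj
      exact (Set.indicator_of_mem (by exact hj) _).symm
    · have hz' : z.1 = z.2 := by
        rw [norm_pos_iff, not_not] at hz
        exact sub_eq_zero.1 hz
      have h0 : H z = 0 := by simp [hHdef, hz']
      simp [Set.indicator_apply, h0]
  have hfinal : 2 * (κ * ∫ x, w x) ≤ 0 :=
    (ge_of_tendsto' hlim fun j => htrunc (t j) (ht0 j) (htε j)).trans hH
  have hint0 : ∫ x, w x = 0 := by
    have h1 : 0 ≤ ∫ x, w x := integral_nonneg hw0
    nlinarith
  exact (integral_eq_zero_iff_of_nonneg hw0 hw).1 hint0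

/-! ### Comparison and conclusion -/

/-- The flux bound in normalized form: at the scale `θ R` the gain from the region where `u` is
small beats the loss due to the curvature of spheres of radius at least `R / 4`. -/
lemma exists_scale {n : ℕ} (hn : 1 ≤ n) {s : ℝ} (hs0 : 0 < s) (hs1 : s < 1) :
    ∃ θ : ℝ, 0 < θ ∧ θ ≤ 1 / 4 ∧ ∀ (R r c τ : ℝ) (p : Rn n) (T : Set (Rn n)) (a : Rn n → ℝ),
      0 < R → R / 4 < r → ‖p‖ ^ 2 + c ^ 2 = r ^ 2 → 0 < τ → τ < θ * R / 2 → MeasurableSet T →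
      volume T ≤ ENNReal.ofReal ((θ * R) ^ n / 8) * volume (Metric.ball (0 : Rn n) 1) →
      AEMeasurable a →
      (∀ y h, ‖y‖ ^ 2 + h ^ 2 + 2 * (⟪p, y⟫ + c * h) < 0 → h ≤ a y) →
      (∀ y, y ∉ T → ‖y‖ < θ * R → θ * R ≤ a y) →
      R ^ (-s) ≤ ∫ y, {y : Rn n | τ < ‖y‖}.indicator
          (fun y => Gs n s (a y / ‖y‖) / ‖y‖ ^ ((n : ℝ) + s)) y := by
  obtain ⟨c₁, C₂, hc₁, hC₂, h⟩ := flux_lower_bound hn hs0 hs1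
  set M : ℝ := (C₂ * (1 / 4) ^ (-s) + 1) / c₁ with hM
  have hM0 : 0 < M := by positivity
  have hθ0 : 0 < min (1 / 4) (M ^ (-1 / s)) := by positivity
  refine ⟨min (1 / 4) (M ^ (-1 / s)), hθ0, min_le_left _ _, ?_⟩
  set θ := min (1 / 4) (M ^ (-1 / s)) with hθ
  have hθM : M ≤ θ ^ (-s) := by
    calc M = (M ^ (-1 / s)) ^ (-s) := by
          rw [← Real.rpow_mul hM0.le]
          have : -1 / s * -s = 1 := by field_simp
          rw [this, Real.rpow_one]
      _ ≤ θ ^ (-s) := Real.rpow_le_rpow_of_nonpos hθ0 (min_le_right _ _) (by linarith)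
  intro R r c τ p T a hR hr hpc hτ hτR hTm hT ha hball haT
  refine le_trans ?_ (h r c (θ * R) τ p T a (by linarith) hpc (by positivity) hτ hτR hTm hT ha
    hball haT)
  have hr' : r ^ (-s) ≤ (1 / 4) ^ (-s) * R ^ (-s) := by
    rw [← Real.mul_rpow (by norm_num) hR.le]
    exact Real.rpow_le_rpow_of_nonpos (by positivity) (by linarith) (by linarith)
  have hR' : 0 < R ^ (-s) := by positivity
  have hc : C₂ * (1 / 4) ^ (-s) + 1 ≤ c₁ * θ ^ (-s) := by
    rw [hM, div_le_iff₀ hc₁] at hθM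
    linarith
  rw [Real.mul_rpow hθ0.le hR.le]
  nlinarith [mul_le_mul_of_nonneg_left hr' hC₂.le, mul_le_mul_of_nonneg_right hc hR'.le]

lemma aemeasurable_of_mem_WObst {n : ℕ} {s : ℝ} {φ ψ u : Rn n → ℝ} {Ω A : Set (Rn n)}
    (hΩ : MeasurableSet Ω) (hφ : AEMeasurable φ) (hu : u ∈ WObst s φ ψ Ω A) : AEMeasurable u := by
  have h1 : AEMeasurable (Ω.indicator u) :=
    (aemeasurable_indicator_iff hΩ).2 hu.1.1.1.aemeasurable
  have h2 : AEMeasurable (Ωᶜ.indicator φ) := hφ.indicator hΩ.compl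
  refine (h1.add h2).congr (ae_of_all _ fun x => ?_)
  by_cases hx : x ∈ Ω
  · simp [hx]
  · simp [hx, hu.2.1 x hx]

/-- Chebyshev's inequality: if `K` is large compared with the mean of `u₊`, then `u ≥ K / 2` only on
a small part of the ball. -/
lemma volume_superlevel_le {n : ℕ} {u : Rn n → ℝ} {x₀ : Rn n} {R C K θ : ℝ} (hn : 1 ≤ n)
    (hR : 0 < R) (hθ : 0 < θ) (hC : 16 * 2 ^ n / θ ^ n ≤ C) (hK : 0 < K)
    (hu : IntegrableOn u (Metric.ball x₀ (2 * R)))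
    (hCK : C * ⨍ x in Metric.ball x₀ (2 * R), max (u x) 0 ≤ K) :
    volume (Metric.ball x₀ (2 * R) ∩ {x | K / 2 ≤ u x}) ≤
      ENNReal.ofReal ((θ * R) ^ n / 8) * volume (Metric.ball (0 : Rn n) 1) := by
  have : Nonempty (Fin n) := ⟨⟨0, hn⟩⟩
  set Ω := Metric.ball x₀ (2 * R) with hΩ
  set ω := volume (Metric.ball (0 : Rn n) 1) with hω
  have hω0 : ω ≠ 0 := (Metric.measure_ball_pos volume _ one_pos).ne'
  have hωt : ω ≠ ⊤ := measure_ball_lt_top.ne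
  have hωr : 0 < ω.toReal := ENNReal.toReal_pos hω0 hωt
  have hΩv : volume.real Ω = (2 * R) ^ n * ω.toReal := by
    rw [Measure.real, hΩ, Measure.addHaar_ball _ _ (by positivity), finrank_euclideanSpace_fin,
      ENNReal.toReal_mul, ENNReal.toReal_ofReal (by positivity)]
  have hi : Integrable (fun x => max (u x) 0) (volume.restrict Ω) := hu.pos_part
  have hmk := mul_meas_ge_le_integral_of_nonneg (ae_of_all _ fun x => le_max_right (u x) 0) hi (K / 2)
  have hset : (volume.restrict Ω).real {x | K / 2 ≤ max (u x) 0} =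
      volume.real (Ω ∩ {x | K / 2 ≤ u x}) := by
    rw [measureReal_restrict_apply' measurableSet_ball, Set.inter_comm]
    congr 2
    ext x
    have : ¬ K ≤ 0 := by linarith
    simp only [Set.mem_ofPred_eq, le_max_iff]
    constructor
    · rintro (h | h)
      · exact h
      · linarith
    · exact Or.inl
  rw [hset] at hmk
  have hC0 : 0 < C := lt_of_lt_of_le (by positivity) hC
  have havg : C * ∫ x in Ω, max (u x) 0 ≤ K * ((2 * R) ^ n * ω.toReal) := by
    rw [setAverage_eq, hΩv, smul_eq_mul] at hCK
    have hpos : 0 < (2 * R) ^ n * ω.toReal := by positivity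
    calc C * ∫ x in Ω, max (u x) 0
        = C * (((2 * R) ^ n * ω.toReal)⁻¹ * ∫ x in Ω, max (u x) 0) * ((2 * R) ^ n * ω.toReal) := by
          field_simp
      _ ≤ _ := by gcongr
  set V := volume.real (Ω ∩ {x | K / 2 ≤ u x}) with hV
  have hV0 : 0 ≤ V := measureReal_nonneg
  have h1 : C * V ≤ 2 * ((2 * R) ^ n * ω.toReal) := by
    have := mul_le_mul_of_nonneg_left hmk hC0.le
    have h2 : K * (C * V) ≤ K * (2 * ((2 * R) ^ n * ω.toReal)) := by linarith
    exact le_of_mul_le_mul_left h2 hK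
  have h2 : V ≤ (θ * R) ^ n / 8 * ω.toReal := by
    rw [div_le_iff₀ (by positivity)] at hC
    have h3 : 16 * 2 ^ n * V ≤ C * θ ^ n * V := by gcongr
    have h4 : C * V * θ ^ n ≤ 2 * ((2 * R) ^ n * ω.toReal) * θ ^ n := by gcongr
    have h5 : (2 : ℝ) ^ n * (16 * V) ≤ 2 ^ n * (2 * ((θ * R) ^ n * ω.toReal)) := by
      rw [mul_pow] at h4
      rw [mul_pow]
      nlinarith
    have := le_of_mul_le_mul_left h5 (by positivity)
    linarith
  have hfin : volume (Ω ∩ {x | K / 2 ≤ u x}) ≠ ⊤ :=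
    measure_ne_top_of_subset Set.inter_subset_left measure_ball_lt_top.ne
  rw [← ENNReal.ofReal_toReal hfin, ← ENNReal.ofReal_toReal hωt,
    ← ENNReal.ofReal_mul (by positivity)]
  exact ENNReal.ofReal_le_ofReal h2

/-- Comparison with the hemisphere: `u` stays below a barrier that touches the level `K` at an
arbitrary point `x₁` of the ball of radius `R`. -/
lemma comparison {n : ℕ} (hn : 1 ≤ n) {s : ℝ} (hs0 : 0 < s) (hs1 : s < 1) :
    ∃ C : ℝ, 0 < C ∧ ∀ (x₀ : Rn n) (R : ℝ), 0 < R → ∀ (A : Set (Rn n)) (φ ψ u : Rn n → ℝ),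
      AEMeasurable φ → SolvesObstacle s φ ψ (Metric.ball x₀ (2 * R)) A u → ∀ K : ℝ,
      C * (R + ⨍ x in Metric.ball x₀ (2 * R), max (u x) 0) ≤ K →
      (∀ᵐ x ∂(volume.restrict A), ψ x ≤ K) → ∀ x₁ ∈ Metric.ball x₀ R,
      ∀ᵐ x, x ∈ Metric.ball x₁ (R / 4) → u x ≤ K + ‖x - x₁‖ := by
  obtain ⟨θ, hθ0, hθ1, hscale⟩ := exists_scale hn hs0 hs1
  refine ⟨max 2 (16 * 2 ^ n / θ ^ n), by positivity, ?_⟩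
  set C := max 2 (16 * 2 ^ n / θ ^ n) with hC
  intro x₀ R hR A φ ψ u hφ hsol K hCK hψK x₁ hx₁
  set Ω := Metric.ball x₀ (2 * R) with hΩ
  have hΩm : MeasurableSet Ω := measurableSet_ball
  have hum : AEMeasurable u := aemeasurable_of_mem_WObst hΩm hφ hsol.1
  have havg0 : 0 ≤ ⨍ x in Ω, max (u x) 0 := by
    rw [setAverage_eq]
    exact smul_nonneg (by positivity) (integral_nonneg fun x => le_max_right _ _)
  have hC2 : 2 ≤ C := le_max_left _ _
  have hKR : 2 * R ≤ K := by nlinarith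
  have hK0 : 0 < K := by linarith
  have hT := volume_superlevel_le hn hR hθ0 (le_max_right 2 _ : _ ≤ C) hK0 hsol.1.1.1
    (by nlinarith : C * ⨍ x in Ω, max (u x) 0 ≤ K)
  set T := toMeasurable volume (Ω ∩ {x | K / 2 ≤ u x}) with hTdef
  have hTm : MeasurableSet T := measurableSet_toMeasurable _ _
  have hTv : volume T ≤
      ENNReal.ofReal ((θ * R) ^ n / 8) * volume (Metric.ball (0 : Rn n) 1) := by
    rw [hTdef, measure_toMeasurable]
    exact hT
  have hsubT : Ω ∩ {x | K / 2 ≤ u x} ⊆ T := subset_toMeasurable _ _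
  set g : Rn n → ENNReal := Ω.indicator fun x => ENNReal.ofReal |u x| with hg
  have hgm : AEMeasurable g := by
    simp_rw [hg, ← Real.norm_eq_abs]
    exact hum.norm.ennreal_ofReal.indicator hΩm
  have hgi : ∫⁻ x, g x < ⊤ := by
    rw [hg, lintegral_indicator hΩm]
    exact lintegral_ofReal_lt_top hsol.1.1.1.abs
  obtain ⟨r, hr1, hr2, hcr⟩ := exists_radius hn hs0 hs1 hgm hgi x₁ hR
  have hr0 : 0 < r := by linarith
  have hB : Metric.ball x₁ r ⊆ Ω := by
    refine Metric.ball_subset_ball' ?_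
    rw [Metric.mem_ball] at hx₁
    linarith
  have hwfin := lintegral_excess_lt_top hn hs0 hs1 hK0.le hr0 hum hΩm hB hsol.1.1.2 hcr
  set w := excess K r x₁ u with hw
  set v : Rn n → ℝ := fun x => u x - w x with hv
  have hwm : AEMeasurable w := aemeasurable_excess hum
  have hvm : AEMeasurable v := hum.sub hwm
  have hvW : v ∈ WObst s φ ψ Ω A :=
    sub_excess_mem_WObst hK0.le hr0.le hum hΩm hB hsol.1 hψK hwfin
  have hwi : Integrable w := integrable_excess hK0.le hr0.le hum hΩm hB hsol.1.1.1
  have huv : ∀ x, u x - v x = w x := fun x => by simp [hv]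
  have hlin := linearized_inequality hn hs0 hum hvm hsol hvW (by simpa only [huv] using hwfin)
  simp only [huv] at hlin
  have hzero : w =ᵐ[volume] 0 := by
    refine ae_eq_zero_of_flux hn hs0 hs1 hvm hwi excess_nonneg hlin.1 hlin.2
      (κ := R ^ (-s)) (ε := θ * R / 2) (by positivity) (by positivity) ?_
    intro τ hτ hτε x hx
    have hxB : x ∈ Metric.ball x₁ r := by
      by_contra h
      exact hx (excess_of_notMem h)
    have hvx : v x = K + hemi r x₁ x := by
      have h1 : w x = max (u x - (K + hemi r x₁ x)) 0 := excess_of_mem hxB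
      rcases max_cases (u x - (K + hemi r x₁ x)) 0 with ⟨h, _⟩ | ⟨h, _⟩
      · rw [h] at h1; simp only [hv, h1]; ring
      · exact absurd (h1.trans h) hx
    have hpr : ‖x - x₁‖ < r := mem_ball_iff_norm.1 hxB
    have hsq : 0 ≤ r ^ 2 - ‖x - x₁‖ ^ 2 := by nlinarith [norm_nonneg (x - x₁)]
    refine hscale R r √(r ^ 2 - ‖x - x₁‖ ^ 2) τ (x - x₁) ((fun y => x + y) ⁻¹' T)
      (fun y => v x - v (x + y)) hR hr1 (by rw [Real.sq_sqrt hsq]; ring) hτ hτε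
      (measurable_const_add x hTm) (by rwa [measure_preimage_add]) ?_ ?_ ?_
    · exact aemeasurable_const.sub (hvm.comp_quasiMeasurePreserving
        (measurePreserving_add_left volume x).quasiMeasurePreserving)
    · intro y h hyh
      have hnorm : ‖x + y - x₁‖ ^ 2 = ‖x - x₁‖ ^ 2 + 2 * ⟪x - x₁, y⟫ + ‖y‖ ^ 2 := by
        rw [add_sub_right_comm, norm_add_sq_real]
      set c := √(r ^ 2 - ‖x - x₁‖ ^ 2) with hc
      have hc2 : c ^ 2 = r ^ 2 - ‖x - x₁‖ ^ 2 := Real.sq_sqrt hsq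
      have hin : ‖x + y - x₁‖ ^ 2 + (h + c) ^ 2 < r ^ 2 := by nlinarith
      have hyB : x + y ∈ Metric.ball x₁ r := by
        rw [mem_ball_iff_norm]
        refine lt_of_pow_lt_pow_left₀ 2 hr0.le ?_
        nlinarith [sq_nonneg (h + c)]
      have h1 : v (x + y) ≤ K + hemi r x₁ (x + y) := sub_excess_le_barrier hyB
      have h2 : h + c ≤ √(r ^ 2 - ‖x + y - x₁‖ ^ 2) := Real.le_sqrt_of_sq_le (by linarith)
      simp only [hemi] at h1 hvx
      rw [← hc] at hvx
      linarith
    · intro y hyT hy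
      have hyΩ : x + y ∈ Ω := by
        rw [hΩ, mem_ball_iff_norm]
        have h1 : ‖x₁ - x₀‖ < R := mem_ball_iff_norm.1 hx₁
        have h2 : x + y - x₀ = (x - x₁) + y + (x₁ - x₀) := by abel
        rw [h2]
        have h3 := norm_add₃_le (a := x - x₁) (b := y) (c := x₁ - x₀)
        nlinarith
      have h1 : u (x + y) < K / 2 := by
        by_contra h
        exact hyT (hsubT ⟨hyΩ, not_lt.1 h⟩)
      have h2 : 0 ≤ w (x + y) := excess_nonneg _
      have h3 := hemi_nonneg hr0.le x₁ x
      have h4 : v (x + y) = u (x + y) - w (x + y) := rfl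
      rw [hvx, h4]
      nlinarith
  filter_upwards [hzero] with x hx hxB
  have hxr : ‖x - x₁‖ < R / 4 := mem_ball_iff_norm.1 hxB
  have hxB' : x ∈ Metric.ball x₁ r := mem_ball_iff_norm.2 (by linarith)
  have h1 : u x - w x ≤ K + hemi r x₁ x := sub_excess_le_barrier hxB'
  have h2 : hemi r x₁ x ≤ ‖x - x₁‖ := hemi_le_norm (by linarith)
  rw [hx, Pi.zero_apply] at h1
  linarith

end NonlocalObstacle

end

theorem theorem2p6 (n : ℕ) (hn : 1 ≤ n) (s : ℝ) (hs0 : 0 < s) (hs1 : s < 1) :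
    ∃ C : ℝ, 0 < C ∧
      ∀ (x₀ : NonlocalObstacle.Rn n) (R : ℝ), 0 < R →
      ∀ (A : Set (NonlocalObstacle.Rn n)), MeasurableSet A → A ⊆ Metric.ball x₀ (2 * R) →
      ∀ (φ ψ u : NonlocalObstacle.Rn n → ℝ),
        AEMeasurable φ volume →
        MemLp ψ ⊤ (volume.restrict A) →
        NonlocalObstacle.SolvesObstacle s φ ψ (Metric.ball x₀ (2 * R)) A u →
        NonlocalObstacle.supOn (Metric.ball x₀ R) u ≤
          max ((C * (R + ⨍ x in Metric.ball x₀ (2 * R), max (u x) 0) : ℝ) : EReal)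
            (NonlocalObstacle.supOn A (fun x => max (ψ x) 0)) := by
  obtain ⟨C, hC, hcomp⟩ := NonlocalObstacle.comparison hn hs0 hs1
  refine ⟨C, hC, fun x₀ R hR A _ _ φ ψ u hφ _ hsol => ?_⟩
  set M : EReal := max ((C * (R + ⨍ x in Metric.ball x₀ (2 * R), max (u x) 0) : ℝ) : EReal)
    (NonlocalObstacle.supOn A (fun x => max (ψ x) 0)) with hM
  rcases eq_or_ne M ⊤ with hMt | hMt
  · rw [hMt]; exact le_top
  have hMb : M ≠ ⊥ := (lt_of_lt_of_le (EReal.bot_lt_coe _) (le_max_left _ _)).ne'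
  obtain ⟨K, hK⟩ : ∃ K : ℝ, (K : EReal) = M := ⟨M.toReal, EReal.coe_toReal hMt hMb⟩
  have hCK : C * (R + ⨍ x in Metric.ball x₀ (2 * R), max (u x) 0) ≤ K := by
    rw [← EReal.coe_le_coe_iff, hK]
    exact le_max_left _ _
  have hψK : ∀ᵐ x ∂(volume.restrict A), ψ x ≤ K := by
    filter_upwards [ae_le_essSup (f := fun x => ((max (ψ x) 0 : ℝ) : EReal))
      (μ := volume.restrict A)] with x hx
    have h : ((max (ψ x) 0 : ℝ) : EReal) ≤ K := hx.trans (hK ▸ le_max_right _ _)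
    exact (le_max_left _ _).trans (EReal.coe_le_coe_iff.1 h)
  -- Let the touching point run through a countable dense subset of the ball.
  have hae : ∀ᵐ x, ∀ i, TopologicalSpace.denseSeq (NonlocalObstacle.Rn n) i ∈ Metric.ball x₀ R →
      x ∈ Metric.ball (TopologicalSpace.denseSeq (NonlocalObstacle.Rn n) i) (R / 4) →
      u x ≤ K + ‖x - TopologicalSpace.denseSeq (NonlocalObstacle.Rn n) i‖ := by
    refine ae_all_iff.2 fun i => ?_
    by_cases hi : TopologicalSpace.denseSeq (NonlocalObstacle.Rn n) i ∈ Metric.ball x₀ R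
    · filter_upwards [hcomp x₀ R hR A φ ψ u hφ hsol K hCK hψK _ hi] with x hx _ using hx
    · exact ae_of_all _ fun x h => absurd h hi
  rw [← hK]
  refine essSup_le_of_ae_le _ ?_
  filter_upwards [ae_restrict_of_ae hae, ae_restrict_mem measurableSet_ball] with x hx hxR
  rw [EReal.coe_le_coe_iff]
  refine le_of_forall_pos_le_add fun ε hε => ?_
  obtain ⟨y, hy, i, rfl⟩ := (TopologicalSpace.denseRange_denseSeq
    (NonlocalObstacle.Rn n)).inter_open_nonempty
    (Metric.ball x₀ R ∩ Metric.ball x (min ε (R / 4))) (Metric.isOpen_ball.inter Metric.isOpen_ball)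
    ⟨x, hxR, Metric.mem_ball_self (by positivity)⟩
  have hd := Metric.mem_ball'.1 hy.2
  rw [dist_eq_norm] at hd
  have h1 := hx i hy.1 (mem_ball_iff_norm.2 (hd.trans_le (min_le_right _ _)))
  linarith [min_le_left ε (R / 4)]
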